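/- Let $\mathrm{Vir}$ be the Virasoro algebra over $\mathbb{C}$, with basis $\{d_i, c : i\in\mathbb{Z}\}$ and relations $[d_i,d_j]=(j-i)d_{i+j}+\delta_{i,-j}\frac{i^3-i}{12}c$, $[c,d_i]=0$. For $\lambda,a\in\mathbb{C}^*$ let $\Omega(\lambda,a,t)=\mathbb{C}[t,\partial]$ with $c$ acting by $0$ and $$d_k(\partial^i f)=\lambda^k(\partial-k)^i\Big(\big(\partial+kt-k(k-1)a\big)f-k(t-ka)f'\Big),\qquad k\in\mathbb{Z},\ i\ge 0,\ f\in\mathbb{C}[t];$$ this is the case $h(t)=t$, $\alpha=a$ of the module $\Omega(\lambda,\alpha,h)=\mathbb{C}[t,\partial]$, in which $c$ acts by $0$ and $$d_k(\partial^i f)=\lambda^k(\partial-k)^i\Big(\big(\partial+kh(t)-k(k-1)\alpha\tfrac{h(t)-h(\alpha)}{t-\alpha}\big)f-k(t-k\alpha)f'\Big).$$ For $\mu,\beta\in\mathbb{C}^*$ let $\Omega(\mu,\beta)=\mathbb{C}[\partial]$ with $c$ acting by $0$ and $$d_k(\partial^r)=\mu^k(\partial-k)^r(\partial-\beta k),\qquad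 k\in\mathbb{Z},\ r\ge 0.$$ **Proposition 4.2.** Let $m,n,m',n'\ge 0$ be integers and let $\lambda_i,a_i$ $(1\le i\le m)$, $\mu_j,\beta_j$ $(1\le j\le n)$, $\lambda'_i,a'_i$ $(1\le i\le m')$, $\mu'_j,\beta'_j$ $(1\le j\le n')$ be nonzero complex numbers such that $\lambda_1,\dots,\lambda_m,\mu_1,\dots,\mu_n$ are pairwise distinct and $\lambda'_1,\dots,\lambda'_{m'},\mu'_1,\dots,\mu'_{n'}$ are pairwise distinct. Let $V,V'$ be irreducible $\mathrm{Vir}$-modules and $K$ an integer such that, for every $k>K$, the operator $d_k$ is locally finite on $V$ and on $V'$ (every vector lies in a finite-dimensional $d_k$-stable subspace). Then $$\bigotimes_{i=1}^{m}\Omega(\lambda_i,a_i,t_i)\otimes\bigotimes_{j=1}^{n}\Omega(\mu_j,\beta_j)\otimes V\;\cong\;\bigotimes_{i=1}^{m'}\Omega(\lambda'_i,a'_i,t'_i)\otimes\bigotimes_{j=1}^{n'}\Omega(\mu'_j,\beta'_j)\otimes V'$$ as $\mathrm{Vir}$-modules (an empty tensor product being the trivial module $\mathbb{C}$) if and only if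 $m=m'$, $n=n'$, $V\cong V'$ as $\mathrm{Vir}$-modules, and there are bijections $\sigma:\{1,\dots,m\}\to\{1,\dots,m'\}$ and $\tau:\{1,\dots,n\}\to\{1,\dots,n'\}$ with $(\lambda'_{\sigma(i)},a'_{\sigma(i)})=(\lambda_i,a_i)$ for all $i$ and $(\mu'_{\tau(j)},\beta'_{\tau(j)})=(\mu_j,\beta_j)$ for all $j$. -/

import Mathlib

open scoped TensorProduct
open Polynomial

noncomputable section

/-! ### Tensor products of finite families of Lie modules -/

namespace PiTensorLie

variable {R L ι : Type*} [CommRing R] [LieRing L] [LieAlgebra R L] [DecidableEq ι]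
variable {M : ι → Type*} [∀ i, AddCommGroup (M i)] [∀ i, Module R (M i)]
variable [∀ i, LieRingModule L (M i)] [∀ i, LieModule R L (M i)]

/-- The operator by which `x` acts on the `i`-th tensor factor, the identity on the others. -/
def single (i : ι) (x : L) : Module.End R (⨂[R] j, M j) :=
  PiTensorProduct.map (Function.update (fun j => (LinearMap.id : M j →ₗ[R] M j)) i
    (LieModule.toEnd R L (M i) x))

theorem single_add (i : ι) (x y : L) :
    (single i (x + y) : Module.End R (⨂[R] j, M j)) = single i x + single i y := by
  simp only [single, map_add, PiTensorProduct.map_update_add]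

theorem single_smul (i : ι) (r : R) (x : L) :
    (single i (r • x) : Module.End R (⨂[R] j, M j)) = r • single i x := by
  simp only [single, map_smul, PiTensorProduct.map_update_smul]

theorem single_tprod (i : ι) (x : L) (v : ∀ j, M j) :
    single i x (PiTensorProduct.tprod R v) =
      PiTensorProduct.tprod R (Function.update v i ⁅x, v i⁆) := by
  simp only [single, PiTensorProduct.map_tprod]
  congr 1
  funext j
  by_cases h : j = i
  · subst h; simp
  · simp [h]

theorem single_comm {i k : ι} (h : i ≠ k) (x y : L) :
    (single i x : Module.End R (⨂[R] j, M j)) * single k y = single k y * single i x := by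
  ext v
  simp only [LinearMap.compMultilinearMap_apply, Module.End.mul_apply, single_tprod]
  rw [Function.update_of_ne h, Function.update_of_ne h.symm, Function.update_comm h]

theorem single_lie (i : ι) (x y : L) :
    (single i ⁅x, y⁆ : Module.End R (⨂[R] j, M j)) =
      single i x * single i y - single i y * single i x := by
  ext v
  simp only [LinearMap.compMultilinearMap_apply, Module.End.mul_apply, single_tprod,
    LinearMap.sub_apply, Function.update_self, Function.update_idem, lie_lie,
    MultilinearMap.map_update_sub]

variable [Fintype ι]

/-- The action of `x` on `⨂ M j`: the sum over `i` of the actions on the `i`-th factor. -/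
def act (x : L) : Module.End R (⨂[R] j, M j) := ∑ i, single i x

theorem act_tprod (x : L) (v : ∀ j, M j) :
    act x (PiTensorProduct.tprod R v) =
      ∑ i, PiTensorProduct.tprod R (Function.update v i ⁅x, v i⁆) := by
  simp only [act, LinearMap.sum_apply, single_tprod]

theorem act_lie (x y : L) :
    (act ⁅x, y⁆ : Module.End R (⨂[R] j, M j)) = act x * act y - act y * act x := by
  have e : ∀ x y : L, (act x : Module.End R (⨂[R] j, M j)) * act y =
      ∑ i, ∑ k, single i x * single k y := by
    intro x y
    simp only [act, Finset.sum_mul, Finset.mul_sum]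
    exact Finset.sum_comm
  rw [e, e, Finset.sum_comm (f := fun i k =>
    (single i y * single k x : Module.End R (⨂[R] j, M j))), ← Finset.sum_sub_distrib]
  simp only [act, single_lie]
  refine Finset.sum_congr rfl fun i _ => ?_
  rw [← Finset.sum_sub_distrib, Finset.sum_eq_single i]
  · intro k _ hk
    rw [single_comm hk.symm, sub_self]
  · simp

instance instLieRingModule : LieRingModule L (⨂[R] j, M j) where
  bracket x t := act x t
  add_lie x y t := by
    change act (x + y) t = act x t + act y t
    simp only [act, single_add, Finset.sum_add_distrib, LinearMap.add_apply]
  lie_add x s t := map_add (act x) s t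
  leibniz_lie x y t := by
    change act x (act y t) = act ⁅x, y⁆ t + act y (act x t)
    rw [act_lie]
    simp

instance instLieModule : LieModule R L (⨂[R] j, M j) where
  smul_lie r x t := by
    change act (r • x) t = r • act x t
    simp only [act, single_smul, LinearMap.sum_apply, LinearMap.smul_apply, Finset.smul_sum]
  lie_smul r x t := map_smul (act x) r t

/-- The Leibniz rule which characterises the action. -/
theorem lie_tprod (x : L) (v : ∀ j, M j) :
    ⁅x, PiTensorProduct.tprod R v⁆ =
      ∑ i, PiTensorProduct.tprod R (Function.update v i ⁅x, v i⁆) :=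
  act_tprod x v

end PiTensorLie

/-! ### The Virasoro algebra -/

/-- The complex Virasoro algebra as a vector space: the first component collects the coordinates
with respect to the `d i`, the second one is the coordinate with respect to `c`. -/
def Vir : Type := (ℤ →₀ ℂ) × ℂ

namespace Vir

instance : AddCommGroup Vir := inferInstanceAs (AddCommGroup ((ℤ →₀ ℂ) × ℂ))
instance : Module ℂ Vir := inferInstanceAs (Module ℂ ((ℤ →₀ ℂ) × ℂ))

/-- The coordinates with respect to the `d i`. -/
def coords : Vir →ₗ[ℂ] (ℤ →₀ ℂ) := LinearMap.fst ℂ (ℤ →₀ ℂ) ℂ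

/-- The basis vector `d i`. -/
def d (i : ℤ) : Vir := (Finsupp.single i 1, 0)

/-- The central basis vector. -/
def c : Vir := (0, 1)

@[simp] theorem coords_d (i : ℤ) : coords (d i) = Finsupp.single i 1 := rfl
@[simp] theorem coords_c : coords c = 0 := rfl

/-- `[d i, d j] = (j - i) d (i + j) + δ_{i, -j} ((i ^ 3 - i) / 12) c`. -/
def dBracket (i j : ℤ) : Vir :=
  ((j : ℂ) - (i : ℂ)) • d (i + j) + (if i = -j then ((i : ℂ) ^ 3 - (i : ℂ)) / 12 else 0) • c

/-- The bilinear extension of `dBracket`, with `c` central. -/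
def bracketLin : Vir →ₗ[ℂ] Vir →ₗ[ℂ] Vir :=
  (Finsupp.linearCombination ℂ fun i : ℤ =>
    (Finsupp.linearCombination ℂ fun j : ℤ => dBracket i j) ∘ₗ coords) ∘ₗ coords

instance : Bracket Vir Vir := ⟨fun x y => bracketLin x y⟩

theorem bracket_def (x y : Vir) : ⁅x, y⁆ = bracketLin x y := rfl

theorem lie_d_d (i j : ℤ) : ⁅d i, d j⁆ = dBracket i j := by
  simp [bracket_def, bracketLin]

theorem lie_c_left (x : Vir) : ⁅c, x⁆ = 0 := by
  simp [bracket_def, bracketLin]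

theorem lie_c_right (x : Vir) : ⁅x, c⁆ = 0 := by
  rw [bracket_def]
  simp only [bracketLin, LinearMap.comp_apply, Finsupp.linearCombination_apply, Finsupp.sum,
    LinearMap.sum_apply, LinearMap.smul_apply, coords_c, map_zero]
  simp

/-- The `d i` together with `c` span. -/
@[elab_as_elim]
theorem induction_on {p : Vir → Prop} (x : Vir) (hc : p c) (hd : ∀ i, p (d i))
    (hadd : ∀ x y, p x → p y → p (x + y)) (hsmul : ∀ (r : ℂ) x, p x → p (r • x)) : p x := by
  obtain ⟨f, r⟩ := x
  have h0 : p 0 := by simpa using hsmul 0 c hc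
  have h1 : ∀ f : ℤ →₀ ℂ, p ((f, 0) : (ℤ →₀ ℂ) × ℂ) := by
    intro f
    induction f using Finsupp.induction_linear with
    | zero => exact h0
    | add f g hf hg =>
      have := hadd _ _ hf hg
      have e : (((f, 0) : (ℤ →₀ ℂ) × ℂ) + (g, 0)) = (f + g, 0) := by simp
      exact e ▸ this
    | single i a =>
      have := hsmul a _ (hd i)
      have e : (a • ((Finsupp.single i 1, 0) : (ℤ →₀ ℂ) × ℂ)) = (Finsupp.single i a, 0) := by simp
      exact e ▸ this
  have := hadd _ _ (h1 f) (hsmul r _ hc)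
  have e : (((f, 0) : (ℤ →₀ ℂ) × ℂ) + r • ((0, 1) : (ℤ →₀ ℂ) × ℂ)) = (f, r) := by simp
  exact e ▸ this

theorem bracketLin_skew (x y : Vir) : bracketLin x y = - bracketLin y x := by
  induction x using induction_on with
  | hc => rw [← bracket_def, ← bracket_def, lie_c_left, lie_c_right, neg_zero]
  | hadd x x' h h' => simp only [map_add, LinearMap.add_apply, h, h', neg_add]
  | hsmul r x h => simp only [map_smul, LinearMap.smul_apply, h, smul_neg]
  | hd i =>
    induction y using induction_on with
    | hc => rw [← bracket_def, ← bracket_def, lie_c_left, lie_c_right, neg_zero]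
    | hadd x x' h h' => simp only [map_add, LinearMap.add_apply, h, h', neg_add]
    | hsmul r x h => simp only [map_smul, LinearMap.smul_apply, h, smul_neg]
    | hd j =>
      rw [← bracket_def, ← bracket_def, lie_d_d, lie_d_d, dBracket, dBracket, add_comm j i]
      by_cases h : i = -j
      · subst h
        simp only [neg_neg, if_true]
        push_cast
        module
      · have h' : j ≠ -i := fun e => h (by omega)
        simp only [if_neg h, if_neg h']
        module

theorem bracketLin_d (i : ℤ) (a b : ℂ) (j : ℤ) :
    bracketLin (d i) (a • d j + b • c) = a • dBracket i j := by
  rw [map_add, map_smul, map_smul, ← bracket_def, ← bracket_def, lie_c_right, lie_d_d, smul_zero,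
    add_zero]

theorem jacobi_d (i j k : ℤ) :
    bracketLin (d i) (dBracket j k) =
      bracketLin (dBracket i j) (d k) + bracketLin (d j) (dBracket i k) := by
  rw [bracketLin_skew (dBracket i j) (d k), dBracket, dBracket, dBracket, bracketLin_d,
    bracketLin_d, bracketLin_d, dBracket, dBracket, dBracket,
    show k + (i + j) = i + (j + k) by ring, show j + (i + k) = i + (j + k) by ring]
  by_cases h : i + j + k = 0
  · obtain rfl : k = -i - j := by omega
    rw [if_pos (by ring), if_pos (by ring), if_pos (by ring)]
    push_cast
    module
  · rw [if_neg (by omega), if_neg (by omega), if_neg (by omega)]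
    push_cast
    module

theorem bracketLin_leibniz (x y z : Vir) :
    bracketLin x (bracketLin y z) =
      bracketLin (bracketLin x y) z + bracketLin y (bracketLin x z) := by
  have cl : ∀ x, bracketLin c x = 0 := lie_c_left
  have cr : ∀ x, bracketLin x c = 0 := lie_c_right
  have dd : ∀ i j, bracketLin (d i) (d j) = dBracket i j := lie_d_d
  induction x using induction_on with
  | hc => simp [cl]
  | hadd x x' h h' => simp only [map_add, LinearMap.add_apply, h, h']; abel
  | hsmul r x h => simp only [map_smul, LinearMap.smul_apply, h, smul_add]
  | hd i =>
    induction y using induction_on with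
    | hc => simp [cl, cr]
    | hadd x x' h h' => simp only [map_add, LinearMap.add_apply, h, h']; abel
    | hsmul r x h => simp only [map_smul, LinearMap.smul_apply, h, smul_add]
    | hd j =>
      induction z using induction_on with
      | hc => simp [cr]
      | hadd x x' h h' => simp only [map_add, h, h']; abel
      | hsmul r x h => simp only [map_smul, h, smul_add]
      | hd k => rw [dd, dd, dd, jacobi_d]

instance : LieRing Vir where
  add_lie x y z := by simp only [bracket_def, map_add, LinearMap.add_apply]
  lie_add x y z := by simp only [bracket_def, map_add]
  lie_self x := by
    have h : bracketLin x x + bracketLin x x = 0 := by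
      nth_rewrite 1 [bracketLin_skew x x]
      exact neg_add_cancel _
    rw [← two_smul ℂ, smul_eq_zero] at h
    exact h.resolve_left two_ne_zero
  leibniz_lie x y z := bracketLin_leibniz x y z

instance : LieAlgebra ℂ Vir where
  lie_smul r x y := by simp only [bracket_def, map_smul]

/-- The linear extension of `d i ↦ D i`, `c ↦ 0`. -/
def opMap {M : Type*} [AddCommGroup M] [Module ℂ M] (D : ℤ → Module.End ℂ M) :
    Vir →ₗ[ℂ] Module.End ℂ M :=
  Finsupp.linearCombination ℂ D ∘ₗ coords

section Operators

variable {M : Type*} [AddCommGroup M] [Module ℂ M] (D : ℤ → Module.End ℂ M)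

theorem opMap_d (i : ℤ) : opMap D (d i) = D i := by simp [opMap]

theorem opMap_c : opMap D c = 0 := by simp [opMap]

theorem opMap_lie (hD : ∀ i j, D i * D j - D j * D i = ((j : ℂ) - (i : ℂ)) • D (i + j))
    (x y : Vir) : opMap D ⁅x, y⁆ = opMap D x * opMap D y - opMap D y * opMap D x := by
  change opMap D (bracketLin x y) = _
  have cl : ∀ x, bracketLin c x = 0 := lie_c_left
  have cr : ∀ x, bracketLin x c = 0 := lie_c_right
  have dd : ∀ i j, bracketLin (d i) (d j) = dBracket i j := lie_d_d
  induction x using induction_on with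
  | hc => simp [cl, opMap_c]
  | hadd x x' h h' =>
    simp only [map_add, LinearMap.add_apply, h, h', add_mul, mul_add]; abel
  | hsmul r x h =>
    simp only [map_smul, LinearMap.smul_apply, h, smul_mul_assoc, mul_smul_comm, smul_sub]
  | hd i =>
    induction y using induction_on with
    | hc => simp [cr, opMap_c]
    | hadd x x' h h' => simp only [map_add, h, h', add_mul, mul_add]; abel
    | hsmul r x h => simp only [map_smul, h, smul_mul_assoc, mul_smul_comm, smul_sub]
    | hd j => rw [dd, opMap_d, opMap_d, hD, dBracket, map_add, map_smul, map_smul, opMap_c,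
        opMap_d, smul_zero, add_zero]

/-- Operators `D i` with `[D i, D j] = (j - i) D (i + j)` give a module over the Virasoro algebra
in which `d i` acts by `D i` and `c` by zero. -/
@[reducible]
def lieRingModuleOfOperators
    (hD : ∀ i j, D i * D j - D j * D i = ((j : ℂ) - (i : ℂ)) • D (i + j)) :
    LieRingModule Vir M where
  bracket x m := opMap D x m
  add_lie x y m := by
    change opMap D (x + y) m = opMap D x m + opMap D y m
    rw [map_add, LinearMap.add_apply]
  lie_add x m n := map_add (opMap D x) m n
  leibniz_lie x y m := by
    change opMap D x (opMap D y m) = opMap D ⁅x, y⁆ m + opMap D y (opMap D x m)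
    rw [opMap_lie D hD]
    simp

theorem lieModuleOfOperators
    (hD : ∀ i j, D i * D j - D j * D i = ((j : ℂ) - (i : ℂ)) • D (i + j)) :
    letI := lieRingModuleOfOperators D hD
    LieModule ℂ Vir M :=
  letI := lieRingModuleOfOperators D hD
  { smul_lie := fun r x m => by
      change opMap D (r • x) m = r • opMap D x m
      rw [map_smul, LinearMap.smul_apply]
    lie_smul := fun r x m => map_smul (opMap D x) r m }

theorem ofOperators_lie_d
    (hD : ∀ i j, D i * D j - D j * D i = ((j : ℂ) - (i : ℂ)) • D (i + j)) (i : ℤ) (m : M) :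
    letI := lieRingModuleOfOperators D hD
    ⁅d i, m⁆ = D i m := by
  change opMap D (d i) m = D i m
  rw [opMap_d]

theorem ofOperators_lie_c
    (hD : ∀ i j, D i * D j - D j * D i = ((j : ℂ) - (i : ℂ)) • D (i + j)) (m : M) :
    letI := lieRingModuleOfOperators D hD
    ⁅c, m⁆ = 0 := by
  change opMap D c m = 0
  rw [opMap_c, LinearMap.zero_apply]

end Operators

/-- `d k` acts locally finitely on `V`: every vector lies in a finite-dimensional subspace which is
stable under `d k`. -/
def ActsLocallyFinitely (V : Type*) [AddCommGroup V] [Module ℂ V] [LieRingModule Vir V]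
    (k : ℤ) : Prop :=
  ∀ v : V, ∃ W : Submodule ℂ V, v ∈ W ∧ FiniteDimensional ℂ W ∧ ∀ w ∈ W, ⁅d k, w⁆ ∈ W

end Vir

/-! ### The modules `Ω(μ, β)` -/

/-- The underlying space `ℂ[∂]` of `Ω(μ, β)`. -/
@[nolint unusedArguments]
def OmegaOne (_mu : ℂˣ) (_β : ℂ) : Type := ℂ[X]

namespace OmegaOne

variable (mu : ℂˣ) (β : ℂ)

instance : AddCommGroup (OmegaOne mu β) := inferInstanceAs (AddCommGroup ℂ[X])
instance : Module ℂ (OmegaOne mu β) := inferInstanceAs (Module ℂ ℂ[X])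

/-- The operator `∂ ^ n ↦ μ ^ k (∂ - k) ^ n (∂ - β k)`, where `X` stands for `∂`. -/
def op (k : ℤ) : Module.End ℂ ℂ[X] :=
  ((mu ^ k : ℂˣ) : ℂ) •
    (LinearMap.mulRight ℂ (X - C (β * (k : ℂ))) ∘ₗ (aeval (X - C (k : ℂ) : ℂ[X])).toLinearMap)

theorem op_apply (k : ℤ) (f : ℂ[X]) :
    op mu β k f = ((mu ^ k : ℂˣ) : ℂ) • (f.comp (X - C (k : ℂ)) * (X - C (β * (k : ℂ)))) := by
  simp [op, comp, aeval_def]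

theorem op_X_pow (k : ℤ) (n : ℕ) :
    op mu β k (X ^ n) =
      ((mu ^ k : ℂˣ) : ℂ) • ((X - C (k : ℂ)) ^ n * (X - C (β * (k : ℂ)))) := by
  simp [op_apply]

theorem op_lie (i j : ℤ) :
    op mu β i * op mu β j - op mu β j * op mu β i = ((j : ℂ) - (i : ℂ)) • op mu β (i + j) := by
  refine LinearMap.ext fun f => ?_
  have e1 : (f.comp (X - C (i : ℂ))).comp (X - C (j : ℂ)) = f.comp (X - C ((i + j : ℤ) : ℂ)) := by
    rw [comp_assoc]; congr 1; simp; ring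
  have e2 : (f.comp (X - C (j : ℂ))).comp (X - C (i : ℂ)) = f.comp (X - C ((i + j : ℤ) : ℂ)) := by
    rw [comp_assoc]; congr 1; simp; ring
  simp only [LinearMap.sub_apply, Module.End.mul_apply, LinearMap.smul_apply, op_apply, mul_comp,
    e1, e2, zpow_add, Units.val_mul, smul_eq_C_mul, C_mul, C_sub]
  simp
  ring

instance : LieRingModule Vir (OmegaOne mu β) :=
  Vir.lieRingModuleOfOperators (M := OmegaOne mu β) (op mu β) (op_lie mu β)

instance : LieModule ℂ Vir (OmegaOne mu β) :=
  Vir.lieModuleOfOperators (M := OmegaOne mu β) (op mu β) (op_lie mu β)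

/-- `d k (∂ ^ n) = μ ^ k (∂ - k) ^ n (∂ - β k)`. -/
theorem lie_d (k : ℤ) (n : ℕ) :
    ⁅Vir.d k, (show OmegaOne mu β from (X ^ n : ℂ[X]))⁆ =
      (show OmegaOne mu β from
        ((mu ^ k : ℂˣ) : ℂ) • ((X - C (k : ℂ)) ^ n * (X - C (β * (k : ℂ))) : ℂ[X])) :=
  (Vir.ofOperators_lie_d (M := OmegaOne mu β) (op mu β) (op_lie mu β) k _).trans (op_X_pow mu β k n)

theorem lie_c (v : OmegaOne mu β) : ⁅Vir.c, v⁆ = 0 :=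
  Vir.ofOperators_lie_c (M := OmegaOne mu β) (op mu β) (op_lie mu β) v

end OmegaOne

/-! ### The modules `Ω(λ, α, h)` -/

/-- The underlying space `ℂ[t, ∂]` of `Ω(λ, α, h)`, as polynomials in `∂` with coefficients
in `ℂ[t]`. -/
@[nolint unusedArguments]
def OmegaTwo (_lam : ℂˣ) (_α : ℂ) (_h : ℂ[X]) : Type := ℂ[X][X]

namespace OmegaTwo

variable (lam : ℂˣ) (α : ℂ) (h : ℂ[X])

instance : AddCommGroup (OmegaTwo lam α h) := inferInstanceAs (AddCommGroup ℂ[X][X])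
instance : Module ℂ (OmegaTwo lam α h) := inferInstanceAs (Module ℂ ℂ[X][X])

/-- The polynomial `(h(t) - h(α)) / (t - α)`. -/
def diffQuot : ℂ[X] := h /ₘ (X - C α)

theorem diffQuot_spec : (X - C α) * diffQuot α h = h - C (h.eval α) := by
  have := modByMonic_add_div h (X - C α)
  rw [modByMonic_X_sub_C_eq_C_eval] at this
  rw [diffQuot]
  linear_combination this

/-- `f ↦ (∂ + m h(t) - m (m - 1) α (h(t) - h(α)) / (t - α)) f - m (t - m α) f'`, the value of
`λ ^ (-m) d m` on `f ∈ ℂ[t]`. Here the inner variable is `t` and the outer one is `∂`. -/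
def opBase (m : ℤ) : ℂ[X] →ₗ[ℂ] ℂ[X][X] where
  toFun f :=
    (X + C (C (m : ℂ) * h - C ((m : ℂ) * ((m : ℂ) - 1) * α) * diffQuot α h)) * C f
      - C (C (m : ℂ) * (X - C ((m : ℂ) * α)) * derivative f)
  map_add' f g := by simp only [map_add, mul_add]; ring
  map_smul' r f := by
    simp only [RingHom.id_apply, smul_eq_C_mul, derivative_C_mul, C_mul]
    rw [← algebraMap_smul ℂ[X] r, smul_eq_C_mul, algebraMap_eq]
    ring

/-- The operator sending `∂ ^ i f`, with `f ∈ ℂ[t]`, to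
`λ ^ m (∂ - m) ^ i ((∂ + m h - m (m - 1) α (h - h(α)) / (t - α)) f - m (t - m α) f')`. -/
def op (m : ℤ) : Module.End ℂ ℂ[X][X] :=
  Polynomial.lsum fun i : ℕ =>
    ((lam ^ m : ℂˣ) : ℂ) •
      (LinearMap.mulLeft ℂ ((X - C (C (m : ℂ))) ^ i : ℂ[X][X]) ∘ₗ opBase α h m)

theorem op_apply (m : ℤ) (i : ℕ) (f : ℂ[X]) :
    op lam α h m (X ^ i * C f) =
      ((lam ^ m : ℂˣ) : ℂ) • ((X - C (C (m : ℂ))) ^ i * opBase α h m f) := by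
  rw [mul_comm, C_mul_X_pow_eq_monomial, op, lsum_apply, sum_monomial_index]
  · simp
  · simp

theorem op_shift (m : ℤ) (q : ℂ[X]) (u : ℂ[X][X]) :
    op lam α h m (q.map C * u) = (q.comp (X - C (m : ℂ))).map C * op lam α h m u := by
  induction u using Polynomial.induction_on' with
  | add u v hu hv => rw [mul_add, map_add, map_add, mul_add, hu, hv]
  | monomial k f =>
    induction q using Polynomial.induction_on' with
    | add p q hp hq =>
      rw [Polynomial.map_add, add_mul, map_add, hp, hq, add_comp, Polynomial.map_add, add_mul]
    | monomial n r =>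
      have e : (monomial n r).map C * (monomial k f : ℂ[X][X]) = X ^ (n + k) * C (C r * f) := by
        rw [map_monomial, monomial_mul_monomial, ← C_mul_X_pow_eq_monomial, mul_comm]
      have e2 : (opBase α h m) (C r * f) = C (C r) * opBase α h m f := by
        rw [← smul_eq_C_mul, map_smul, ← algebraMap_smul ℂ[X] r, smul_eq_C_mul, algebraMap_eq]
      rw [e, op_apply, e2, ← C_mul_X_pow_eq_monomial (n := k), mul_comm (C f), op_apply]
      have e3 : ((monomial n r).comp (X - C (m : ℂ))).map C =
          C (C r) * (X - C (C (m : ℂ)) : ℂ[X][X]) ^ n := by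
        rw [monomial_comp, Polynomial.map_mul, Polynomial.map_pow, Polynomial.map_sub, map_C,
          map_C, map_X]
      rw [e3, mul_smul_comm, pow_add]
      generalize (X - C (C (m : ℂ)) : ℂ[X][X]) = A
      generalize opBase α h m f = B
      have e4 : A ^ n * A ^ k * (C (C r) * B) = C (C r) * A ^ n * (A ^ k * B) := by ring
      rw [e4]

theorem op_lie (i j : ℤ) :
    op lam α h i * op lam α h j - op lam α h j * op lam α h i =
      ((j : ℂ) - (i : ℂ)) • op lam α h (i + j) := by
  have key : ∀ (i j : ℤ) (n : ℕ) (f : ℂ[X]), op lam α h i (op lam α h j (X ^ n * C f)) =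
      ((lam ^ (i + j) : ℂˣ) : ℂ) • ((X - C (C ((i + j : ℤ) : ℂ))) ^ n *
        ((X - C (C (i : ℂ))) * opBase α h i f +
          opBase α h i ((C (j : ℂ) * h - C ((j : ℂ) * ((j : ℂ) - 1) * α) * diffQuot α h) * f
            - C (j : ℂ) * (X - C ((j : ℂ) * α)) * derivative f))) := by
    intro i j n f
    have hX : ∀ g : ℂ[X], op lam α h i (C g) =
        ((lam ^ i : ℂˣ) : ℂ) • opBase α h i g := by
      intro g
      have := op_apply lam α h i 0 g
      rwa [pow_zero, pow_zero, one_mul, one_mul] at this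
    have hX1 : ∀ g : ℂ[X], op lam α h i (X * C g) =
        ((lam ^ i : ℂˣ) : ℂ) • ((X - C (C (i : ℂ))) * opBase α h i g) := by
      intro g
      have := op_apply lam α h i 1 g
      rwa [pow_one, pow_one] at this
    have e : (X - C (C (j : ℂ)) : ℂ[X][X]) ^ n = ((X - C (j : ℂ)) ^ n : ℂ[X]).map C := by
      rw [Polynomial.map_pow, Polynomial.map_sub, map_C, map_X]
    rw [op_apply, map_smul, e, op_shift]
    have e' : (((X - C (j : ℂ)) ^ n : ℂ[X]).comp (X - C (i : ℂ))).map C =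
        (X - C (C ((i + j : ℤ) : ℂ)) : ℂ[X][X]) ^ n := by
      rw [pow_comp, sub_comp, X_comp, C_comp, Polynomial.map_pow, Polynomial.map_sub,
        Polynomial.map_sub, map_C, map_C, map_X, Int.cast_add, C_add, C_add, sub_sub]
    have e'' : opBase α h j f = X * C f +
        C ((C (j : ℂ) * h - C ((j : ℂ) * ((j : ℂ) - 1) * α) * diffQuot α h) * f
            - C (j : ℂ) * (X - C ((j : ℂ) * α)) * derivative f) := by
      rw [C_sub, C_mul (b := f), ← add_sub_assoc, ← add_mul]
      rfl
    rw [e', e'', map_add, hX, hX1, ← smul_add, mul_smul_comm, smul_smul, ← Units.val_mul,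
      ← zpow_add, add_comm j i]
  refine LinearMap.ext fun p => ?_
  induction p using Polynomial.induction_on' with
  | add u v hu hv => rw [map_add, map_add, hu, hv]
  | monomial n f =>
    rw [← C_mul_X_pow_eq_monomial, mul_comm, LinearMap.sub_apply, Module.End.mul_apply,
      Module.End.mul_apply, key, key, LinearMap.smul_apply,
      op_apply, add_comm j i, ← smul_sub, smul_comm]
    congr 1
    rw [← mul_sub, ← mul_smul_comm]
    congr 1
    rw [← algebraMap_smul ℂ[X] ((j : ℂ) - (i : ℂ)), smul_eq_C_mul, algebraMap_eq]
    have hq := diffQuot_spec α h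
    simp only [opBase, LinearMap.coe_mk, AddHom.coe_mk]
    generalize diffQuot α h = q at hq ⊢
    generalize h.eval α = r at hq
    obtain rfl : h = (X - C α) * q + C r := by rw [hq]; ring
    simp only [derivative_mul, derivative_sub, derivative_add, derivative_C, derivative_X,
      derivative_one, C_sub, C_mul, C_add, Int.cast_add, C_1, C_0]
    ring

instance : LieRingModule Vir (OmegaTwo lam α h) :=
  Vir.lieRingModuleOfOperators (M := OmegaTwo lam α h) (op lam α h) (op_lie lam α h)

instance : LieModule ℂ Vir (OmegaTwo lam α h) :=
  Vir.lieModuleOfOperators (M := OmegaTwo lam α h) (op lam α h) (op_lie lam α h)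

/-- `d m (∂ ^ i f) = λ ^ m (∂ - m) ^ i
((∂ + m h - m (m - 1) α (h - h(α)) / (t - α)) f - m (t - m α) f')`. -/
theorem lie_d (m : ℤ) (i : ℕ) (f : ℂ[X]) :
    ⁅Vir.d m, (show OmegaTwo lam α h from (X ^ i * C f : ℂ[X][X]))⁆ =
      (show OmegaTwo lam α h from
        ((lam ^ m : ℂˣ) : ℂ) • ((X - C (C (m : ℂ))) ^ i *
          ((X + C (C (m : ℂ) * h - C ((m : ℂ) * ((m : ℂ) - 1) * α) * diffQuot α h)) * C f
            - C (C (m : ℂ) * (X - C ((m : ℂ) * α)) * derivative f)) : ℂ[X][X])) :=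
  (Vir.ofOperators_lie_d (M := OmegaTwo lam α h) (op lam α h) (op_lie lam α h) m _).trans (op_apply lam α h m i f)

theorem lie_c (v : OmegaTwo lam α h) : ⁅Vir.c, v⁆ = 0 :=
  Vir.ofOperators_lie_c (M := OmegaTwo lam α h) (op lam α h) (op_lie lam α h) v

end OmegaTwo

end

/-! The proof reads each tensor factor off the large-`k` behaviour of `d k`. On `Ω(λ,a,t)` or
`Ω(μ,β)`, for a fixed vector `u`, the sequence `k ↦ d k u` is `λ ^ k` (resp. `μ ^ k`) times a
polynomial in `k`. On `V`, every vector is killed by `d k` for all large `k`. Hence on the tensor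
product the action of `d k` is a sum of exponential polynomials with pairwise distinct bases, one
for each `Ω` factor, plus a term that eventually vanishes.

Sequences of the first kind with distinct nonzero bases are linearly independent even when only
large `k` is tested. So an isomorphism must intertwine the operators with the same base separately,
for every `k`, and then also the actions on the last factor (`intertwine_of_sum`). A base present on
one side only is impossible, since its operators would be annihilated although `d 0` is injective on
each `Ω`.

Restricted to the operators of a single factor, the tensor product is a direct sum of copies of that
factor (`IsSumOfCopies`). A nonzero map of such sums yields a nonzero map between the single factors
(`IsSumOfCopies.exists_intertwiner`). For equal bases, computations with leading coefficients or
roots force equal parameters and forbid maps `Ω(λ,β) → Ω(λ,a,t)`. For `V` and `V'`, Schur's lemma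
gives the isomorphism.

That local finiteness forces eventual vanishing on `V` is `Vir.exists_forall_lie_eq_zero`. An
eigenvector of some `d n` generates, under the `d i` with `i > n`, a finite-dimensional space, on
which almost all of these operators are zero. The vectors killed by almost all `d k` form a
submodule, which is everything by irreducibility.

The converse is reindexing of tensor products. -/

noncomputable section

/-! ### Local nilpotency of the positive part -/

namespace WittOperators

variable {V : Type*} [AddCommGroup V] [Module ℂ V]

/-- The operators `D i`, `i > n`, satisfy the commutation relations of the Witt algebra. -/
def Relations (D : ℤ → Module.End ℂ V) (n : ℤ) : Prop :=
  ∀ i > n, ∀ j > n, ∀ v, D i (D j v) - D j (D i v) = ((j : ℂ) - (i : ℂ)) • D (i + j) v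

/-- All shifts by at least `s₀` of a linear relation with coefficients `c`. -/
def ShiftedRelation (D : ℤ → Module.End ℂ V) (c : ℤ →₀ ℂ) (s₀ : ℤ) : Prop :=
  ∀ s ≥ s₀, c.sum (fun k r => r • D (k + s)) = 0

/-- This is the commutator of `D i` with the given relation. -/
theorem bracket_relation {D : ℤ → Module.End ℂ V} {n : ℤ} (hD : Relations D n) {c : ℤ →₀ ℂ}
    {s : ℤ} (hc : ∀ k ∈ c.support, n < k + s) (h : c.sum (fun k r => r • D (k + s)) = 0)
    {i : ℤ} (hi : n < i) :
    c.sum (fun k r => (r * ((k : ℂ) + s - i)) • D (k + (s + i))) = 0 := by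
  ext v
  have h1 : ∀ u, ∑ k ∈ c.support, c k • D (k + s) u = 0 := fun u => by
    simpa [Finsupp.sum, LinearMap.sum_apply] using LinearMap.congr_fun h u
  have h2 := h1 (D i v)
  have h3 := congrArg (D i) (h1 v)
  rw [map_sum, map_zero] at h3
  simp only [Finsupp.sum, LinearMap.sum_apply, LinearMap.smul_apply, LinearMap.zero_apply]
  rw [← sub_zero (0 : V)]
  nth_rewrite 1 [← h3]
  rw [← h2, ← Finset.sum_sub_distrib]
  refine Finset.sum_congr rfl fun k hk => ?_
  have := hD i hi (k + s) (hc k hk) v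
  rw [map_smul, ← smul_sub, this, smul_smul, show i + (k + s) = k + (s + i) by ring]
  push_cast
  rfl

/-- Commuting with `D i` and then with `D (s - i)` shifts all indices by `s`, whatever `i` is, and
multiplies the coefficients by a polynomial in `i` of degree two with leading coefficient `-2`. A
second difference in `i` leaves the constant `-4`. -/
theorem shiftedRelation_of_relation {D : ℤ → Module.End ℂ V} {n : ℤ} (hn : 0 ≤ n)
    (hD : Relations D n) {c : ℤ →₀ ℂ} (hc : ∀ k ∈ c.support, n < k)
    (h : c.sum (fun k r => r • D k) = 0) : ShiftedRelation D c (2 * n + 4) := by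
  intro s hs
  have key : ∀ i, n < i → n < s - i → ∑ k ∈ c.support,
      (c k * ((k : ℂ) - i) * ((k : ℂ) + 2 * i - s)) • D (k + s) = 0 := by
    intro i hi hsi
    have h1 := bracket_relation (s := 0) hD (by simpa using hc) (by simpa using h) hi
    let c' : ℤ →₀ ℂ := Finsupp.onFinset c.support (fun k => c k * ((k : ℂ) - i)) (by
      intro k hk; rw [Finsupp.mem_support_iff]; intro h0; simp [h0] at hk)
    have hsub : c'.support ⊆ c.support := Finsupp.support_onFinset_subset
    have e : ∀ g : ℤ → ℂ → Module.End ℂ V, (∀ k, g k 0 = 0) →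
        c'.sum g = ∑ k ∈ c.support, g k (c k * ((k : ℂ) - i)) := by
      intro g hg
      rw [Finsupp.sum_of_support_subset c' hsub g (fun k _ => hg k)]
      rfl
    have h4 := bracket_relation (s := i) (c := c') hD
      (fun k hk => by have := hc k (hsub hk); omega) (by
        rw [e _ (by simp)]
        simpa [Finsupp.sum] using h1) hsi
    rw [e _ (by simp)] at h4
    rw [← h4]
    refine Finset.sum_congr rfl fun k _ => ?_
    rw [show k + (i + (s - i)) = k + s by ring]
    congr 1
    push_cast
    ring
  -- Three consecutive values of `i`; the last one needs `n < s - (n + 3)`, whence the bound `2 * n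
  -- + 4`.
  have k1 := key (n + 1) (by omega) (by omega)
  have k2 := key (n + 2) (by omega) (by omega)
  have k3 := key (n + 3) (by omega) (by omega)
  have : (-4 : ℂ) • ∑ k ∈ c.support, c k • D (k + s) = 0 := by
    have e : (-4 : ℂ) • ∑ k ∈ c.support, c k • D (k + s) = (0 : Module.End ℂ V) - (2 : ℂ) • 0 + 0 := by
      nth_rewrite 1 [← k3]
      nth_rewrite 1 [← k2]
      rw [← k1, Finset.smul_sum, Finset.smul_sum, ← Finset.sum_sub_distrib,
        ← Finset.sum_add_distrib]
      refine Finset.sum_congr rfl fun k _ => ?_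
      push_cast
      module
    simpa using e
  exact (smul_eq_zero.mp this).resolve_left (by norm_num)

/-- Induction on the number of terms. Bracketing a shifted relation multiplies its `k`-th
coefficient by `k` plus a constant; subtracting a multiple of the relation with the same shift turns
this factor into `k - k₁` and removes the term `k₁`. A relation with one term says that all later
operators vanish. -/
theorem eventually_zero_of_shiftedRelation {D : ℤ → Module.End ℂ V} {n : ℤ} (hn : 0 ≤ n)
    (hD : Relations D n) : ∀ (m : ℕ) (c : ℤ →₀ ℂ) (s₀ : ℤ), c.support.card = m + 1 →
    ShiftedRelation D c s₀ → ∃ N, ∀ i ≥ N, D i = 0 := by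
  intro m
  induction m with
  | zero =>
    intro c s₀ hcard h
    obtain ⟨k, r, hr, rfl⟩ := Finsupp.card_support_eq_one'.mp hcard
    refine ⟨k + s₀, fun i hi => ?_⟩
    have := h (i - k) (by omega)
    rw [Finsupp.sum_single_index (by simp), show k + (i - k) = i by ring] at this
    exact (smul_eq_zero.mp this).resolve_left hr
  | succ m ih =>
    intro c s₀ hcard h
    obtain ⟨k₁, hk₁⟩ : c.support.Nonempty := Finset.card_pos.mp (by omega)
    obtain ⟨B, hB⟩ : ∃ B : ℤ, ∀ k ∈ c.support, B ≤ k :=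
      ⟨c.support.inf' ⟨k₁, hk₁⟩ id, fun k hk => Finset.inf'_le id hk⟩
    let c' : ℤ →₀ ℂ := Finsupp.onFinset c.support (fun k => c k * ((k : ℂ) - k₁)) (by
      intro k hk; rw [Finsupp.mem_support_iff]; intro h0; simp [h0] at hk)
    have hsup : c'.support = c.support.erase k₁ := by
      ext k
      simp only [c', Finsupp.mem_support_iff, Finsupp.onFinset_apply, Finset.mem_erase, ne_eq,
        mul_eq_zero, sub_eq_zero, Int.cast_inj, not_or]
      tauto
    -- The first bound makes the shift `s - (n + 1)` admissible for `c`; the second keeps all its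
    -- indices above `n`.
    refine ih c' (max (s₀ + n + 1) (2 * n + 2 - B)) (by
      rw [hsup, Finset.card_erase_of_mem hk₁, hcard]; rfl) ?_
    intro s hs
    have hs1 : s ≥ s₀ := by omega
    have h0 := h s hs1
    have h1 := bracket_relation hD (c := c) (s := s - (n + 1)) (i := n + 1)
      (fun k hk => by have := hB k hk; omega) (h _ (by omega)) (by omega)
    rw [Finsupp.sum_of_support_subset c' (Finsupp.support_onFinset_subset) _ (by simp)]
    simp only [c', Finsupp.onFinset_apply]
    rw [show s - (n + 1) + (n + 1) = s by ring] at h1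
    simp only [Finsupp.sum] at h0 h1
    have e : ∑ k ∈ c.support, (c k * ((k : ℂ) - k₁)) • D (k + s) =
        ∑ k ∈ c.support, (c k * ((k : ℂ) + ((s - (n + 1) : ℤ) : ℂ) - ((n + 1 : ℤ) : ℂ))) • D (k + s) -
        ((s : ℂ) - 2 * (n + 1) + k₁) • ∑ k ∈ c.support, c k • D (k + s) := by
      rw [Finset.smul_sum, ← Finset.sum_sub_distrib]
      refine Finset.sum_congr rfl fun k _ => ?_
      push_cast
      module
    rw [e, h0, h1, smul_zero, sub_zero]

/-- In a finite-dimensional representation of the positive part of the Witt algebra, almost all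
basis vectors act by zero. -/
theorem eventually_zero [FiniteDimensional ℂ V] {D : ℤ → Module.End ℂ V} {n : ℤ} (hn : 0 ≤ n)
    (hD : Relations D n) : ∃ N, ∀ i ≥ N, D i = 0 := by
  have hdep : ¬ LinearIndependent ℂ (fun k : Set.Ioi n => D k) := by
    intro hli
    have := hli.finite
    exact (Set.Ioi_infinite n) (Set.toFinite _)
  rw [linearIndependent_iff] at hdep
  push Not at hdep
  obtain ⟨c, hc, hc0⟩ := hdep
  have h := shiftedRelation_of_relation (c := c.embDomain (Function.Embedding.subtype _)) hn hD
    (by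
      intro k hk
      rw [Finsupp.support_embDomain, Finset.mem_map] at hk
      obtain ⟨x, _, rfl⟩ := hk
      exact x.2)
    (by
      rw [Finsupp.sum_embDomain]
      exact hc)
  have hpos : 0 < c.support.card := Finset.card_pos.mpr (Finsupp.support_nonempty_iff.mpr hc0)
  exact eventually_zero_of_shiftedRelation hn hD (c.support.card - 1) _ _
    (by rw [Finsupp.support_embDomain, Finset.card_map]; omega) h

end WittOperators

/-! ### Finite-dimensional modules generated by one vector, by a Poincaré–Birkhoff–Witt argument. -/

namespace WittOperators

variable {V : Type*} [AddCommGroup V] [Module ℂ V]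

/-- The filtration of the module generated by `w`: products of at most `N` operators `D i` with
`i > n`, applied to `w`. -/
def filtration (D : ℤ → Module.End ℂ V) (n : ℤ) (w : V) : ℕ → Submodule ℂ V
  | 0 => Submodule.span ℂ {w}
  | N + 1 => filtration D n w N ⊔ ⨆ i : Set.Ioi n, (filtration D n w N).map (D i)

/-- The product of the operators `D i`, `i ∈ l`, applied to `w`. -/
def word (D : ℤ → Module.End ℂ V) (w : V) (l : List ℤ) : V := l.foldr (fun i u => D i u) w

section

variable {D : ℤ → Module.End ℂ V} {n : ℤ} {w : V}

@[simp] theorem word_cons (i : ℤ) (l : List ℤ) : word D w (i :: l) = D i (word D w l) := rfl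

theorem word_append (l l' : List ℤ) : word D w (l ++ l') = word D (word D w l') l := by
  simp [word]

theorem word_replicate (b : ℕ) (j : ℤ) : word D w (List.replicate b j) = (D j ^ b) w := by
  induction b with
  | zero => rfl
  | succ b ih => rw [List.replicate_succ, word_cons, ih, pow_succ', Module.End.mul_apply]

theorem filtration_le_succ (N : ℕ) : filtration D n w N ≤ filtration D n w (N + 1) := le_sup_left

theorem filtration_mono : Monotone (filtration D n w) := monotone_nat_of_le_succ filtration_le_succ

theorem apply_mem_filtration {i : ℤ} (hi : n < i) {N : ℕ} {u : V} (hu : u ∈ filtration D n w N) :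
    D i u ∈ filtration D n w (N + 1) :=
  Submodule.mem_sup_right (Submodule.mem_iSup_of_mem (⟨i, hi⟩ : Set.Ioi n)
    (Submodule.mem_map_of_mem hu))

theorem mem_filtration_zero : w ∈ filtration D n w 0 := Submodule.mem_span_singleton_self w

theorem word_mem_filtration {l : List ℤ} (hl : ∀ i ∈ l, n < i) {u : V} {N : ℕ}
    (hu : u ∈ filtration D n w N) : word D u l ∈ filtration D n w (N + l.length) := by
  induction l with
  | nil => exact hu
  | cons i l ih =>
    exact apply_mem_filtration (hl i List.mem_cons_self)
      (ih fun j hj => hl j (List.mem_cons_of_mem _ hj))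

/-- Transposing two adjacent letters produces a commutator, that is, a word with one letter less. -/
theorem word_perm (hn : 0 ≤ n) (hD : Relations D n) {l l' : List ℤ} (h : l.Perm l') :
    ∀ N, (∀ i ∈ l, n < i) → l.length ≤ N + 1 → word D w l - word D w l' ∈ filtration D n w N := by
  induction h with
  | nil => intro N _ _; simp
  | @cons x l₁ l₂ p ih =>
    intro N hl hN
    rw [word_cons, word_cons, ← map_sub]
    rw [List.length_cons] at hN
    rcases N with _ | N
    · obtain rfl : l₁ = [] := List.length_eq_zero_iff.mp (by omega)
      obtain rfl := List.nil_perm.mp p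
      simp
    · exact apply_mem_filtration (hl x List.mem_cons_self)
        (ih N (fun j hj => hl j (List.mem_cons_of_mem _ hj)) (by omega))
  | swap x y l =>
    intro N hl hN
    simp only [List.length_cons] at hN
    have hx : n < x := hl x (by simp)
    have hy : n < y := hl y (by simp)
    rw [word_cons, word_cons, word_cons, word_cons, hD y hy x hx]
    refine Submodule.smul_mem _ _ (filtration_mono (by omega : 0 + l.length + 1 ≤ N) ?_)
    exact apply_mem_filtration (by omega)
      (word_mem_filtration (fun i hi => hl i (by simp [hi])) mem_filtration_zero)
  | trans p₁ p₂ ih₁ ih₂ =>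
    intro N hl hN
    rw [← sub_add_sub_cancel]
    exact add_mem (ih₁ N hl hN) (ih₂ N (fun i hi => hl i (p₁.mem_iff.mpr hi))
      (by rw [← p₁.length_eq]; exact hN))

variable {J : Finset ℤ}

/-- Modulo the filtration only the finitely many operators `D j`, `j ∈ J`, are needed, although `J`
is only known to suffice on `w`. In the inductive step `D i` is moved past `D k`, the induction
hypothesis rewrites `D i u` by letters of `J`, and each such letter is moved to the front. Every
commutator is a single operator and costs no length. -/
theorem map_filtration_le (hn : 0 ≤ n) (hD : Relations D n) (hJn : ∀ j ∈ J, n < j)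
    (hJ : ∀ i > n, D i w ∈ Submodule.span ℂ ((fun j => D j w) '' J)) (N : ℕ) :
    ∀ i > n, (filtration D n w N).map (D i) ≤
      filtration D n w N ⊔ ⨆ j ∈ J, (filtration D n w N).map (D j) := by
  induction N with
  | zero =>
    intro i hi
    change (Submodule.span ℂ {w}).map (D i) ≤ _
    rw [Submodule.map_span, Set.image_singleton, Submodule.span_singleton_le_iff_mem]
    refine Submodule.mem_sup_right ?_
    refine Submodule.span_le.mpr ?_ (hJ i hi)
    rintro _ ⟨j, hj, rfl⟩
    exact Submodule.mem_iSup_of_mem j (Submodule.mem_iSup_of_mem hj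
      (Submodule.mem_map_of_mem mem_filtration_zero))
  | succ N ih =>
    intro i hi
    set T := filtration D n w (N + 1) ⊔ ⨆ j ∈ J, (filtration D n w (N + 1)).map (D j) with hT
    have hTJ : ∀ j ∈ J, ∀ u ∈ filtration D n w (N + 1), D j u ∈ T := fun j hj u hu =>
      Submodule.mem_sup_right (Submodule.mem_iSup_of_mem j (Submodule.mem_iSup_of_mem hj
        (Submodule.mem_map_of_mem hu)))
    have hT1 : filtration D n w (N + 1) ≤ T := le_sup_left
    rw [show filtration D n w (N + 1) =
      filtration D n w N ⊔ ⨆ i : Set.Ioi n, (filtration D n w N).map (D i) from rfl,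
      Submodule.map_sup, Submodule.map_iSup]
    refine sup_le ?_ (iSup_le ?_)
    · rintro _ ⟨u, hu, rfl⟩
      exact hT1 (apply_mem_filtration hi hu)
    · rintro ⟨k, hk⟩ _ ⟨_, ⟨u, hu, rfl⟩, rfl⟩
      have hk : n < k := hk
      have hrel := hD i hi k hk u
      rw [sub_eq_iff_eq_add] at hrel
      rw [hrel]
      refine add_mem (Submodule.smul_mem _ _ (hT1 (apply_mem_filtration (by omega) hu))) ?_
      have hmem : ∀ y ∈ filtration D n w N ⊔ ⨆ j ∈ J, (filtration D n w N).map (D j),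
          D k y ∈ T := by
        intro y hy
        have : filtration D n w N ⊔ ⨆ j ∈ J, (filtration D n w N).map (D j) ≤ T.comap (D k) := by
          refine sup_le ?_ (iSup₂_le ?_)
          · intro z hz
            exact hT1 (apply_mem_filtration hk hz)
          · rintro j hj _ ⟨z, hz, rfl⟩
            rw [Submodule.mem_comap]
            have hr := hD k hk j (hJn j hj) z
            rw [sub_eq_iff_eq_add] at hr
            rw [hr]
            have hj' := hJn j hj
            exact add_mem (Submodule.smul_mem _ _ (hT1 (apply_mem_filtration (by omega) hz)))
              (hTJ j hj _ (apply_mem_filtration hk hz))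
        exact this hy
      exact hmem _ (ih i hi (Submodule.mem_map_of_mem hu))

theorem filtration_succ_eq (hn : 0 ≤ n) (hD : Relations D n) (hJn : ∀ j ∈ J, n < j)
    (hJ : ∀ i > n, D i w ∈ Submodule.span ℂ ((fun j => D j w) '' J)) (N : ℕ) :
    filtration D n w (N + 1) =
      filtration D n w N ⊔ ⨆ j ∈ J, (filtration D n w N).map (D j) := by
  refine le_antisymm (sup_le le_sup_left (iSup_le fun i =>
    map_filtration_le hn hD hJn hJ N i i.2)) (sup_le le_sup_left (iSup₂_le fun j hj => ?_))
  rintro _ ⟨u, hu, rfl⟩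
  exact apply_mem_filtration (hJn j hj) hu

theorem fg_filtration (hn : 0 ≤ n) (hD : Relations D n) (hJn : ∀ j ∈ J, n < j)
    (hJ : ∀ i > n, D i w ∈ Submodule.span ℂ ((fun j => D j w) '' J)) (N : ℕ) :
    (filtration D n w N).FG := by
  induction N with
  | zero => exact Submodule.fg_span_singleton w
  | succ N ih =>
    rw [filtration_succ_eq hn hD hJn hJ]
    exact ih.sup (Submodule.fg_biSup J _ fun j _ => ih.map _)

theorem filtration_succ_le_words (hn : 0 ≤ n) (hD : Relations D n) (hJn : ∀ j ∈ J, n < j)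
    (hJ : ∀ i > n, D i w ∈ Submodule.span ℂ ((fun j => D j w) '' J)) (N : ℕ) :
    filtration D n w (N + 1) ≤ filtration D n w N ⊔
      Submodule.span ℂ (word D w '' {l | l.length = N + 1 ∧ ∀ i ∈ l, i ∈ J}) := by
  induction N with
  | zero =>
    rw [filtration_succ_eq hn hD hJn hJ]
    refine sup_le_sup le_rfl (iSup₂_le fun j hj => ?_)
    change (Submodule.span ℂ {w}).map (D j) ≤ _
    rw [Submodule.map_span, Set.image_singleton, Submodule.span_singleton_le_iff_mem]
    exact Submodule.subset_span ⟨[j], by simp [hj], rfl⟩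
  | succ N ih =>
    conv_lhs => rw [filtration_succ_eq hn hD hJn hJ]
    refine sup_le le_sup_left (iSup₂_le fun j hj => ?_)
    refine (Submodule.map_mono ih).trans ?_
    rw [Submodule.map_sup, Submodule.map_span]
    refine sup_le_sup ?_ (Submodule.span_le.mpr ?_)
    · rintro _ ⟨u, hu, rfl⟩
      exact apply_mem_filtration (hJn j hj) hu
    · rintro _ ⟨_, ⟨l, ⟨hl, hl'⟩, rfl⟩, rfl⟩
      exact Submodule.subset_span ⟨j :: l, ⟨by simp [hl], by
        intro i hi
        rcases List.mem_cons.mp hi with rfl | hi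
        · exact hj
        · exact hl' i hi⟩, rfl⟩

/-- Pigeonhole: some letter `j` occurs at least `b` times. Modulo shorter words, `b` copies of it
can be moved next to `w`, where `D j ^ b` reduces to lower powers. -/
theorem word_mem_of_length (hn : 0 ≤ n) (hD : Relations D n) (hJn : ∀ j ∈ J, n < j) {b : ℕ}
    (hb : ∀ j ∈ J, (D j ^ b) w ∈ Submodule.span ℂ ((fun s => (D j ^ s) w) '' {s | s < b}))
    {N : ℕ} (hN : J.card * b ≤ N) {l : List ℤ} (hl : l.length = N + 1) (hlJ : ∀ i ∈ l, i ∈ J) :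
    word D w l ∈ filtration D n w N := by
  classical
  obtain ⟨j, hj, hbj⟩ : ∃ j ∈ J, b ≤ l.count j := by
    by_contra! hcon
    have h1 : ∑ j ∈ J, l.count j = l.length := by
      have := Multiset.sum_count_eq_card (s := J) (m := (l : Multiset ℤ)) (by simpa using hlJ)
      simpa using this
    have h2 : ∑ j ∈ J, l.count j ≤ J.card * b := by
      rw [← smul_eq_mul]
      exact Finset.sum_le_card_nsmul _ _ _ fun j hj => (hcon j hj).le
    omega
  set l' := l.filter (fun i => i ≠ j) ++ List.replicate (l.count j - b) j with hl'
  have hperm : l.Perm (l' ++ List.replicate b j) := by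
    rw [List.perm_iff_count]
    intro i
    by_cases hij : i = j
    · subst hij
      have h0 : (l.filter (fun k => k ≠ i)).count i = 0 :=
        List.count_eq_zero_of_not_mem (by simp)
      rw [hl', List.count_append, List.count_append, List.count_replicate_self,
        List.count_replicate_self, h0]
      omega
    · rw [hl', List.count_append, List.count_append, List.count_filter (by simpa using hij),
        List.count_replicate, List.count_replicate]
      simp [Ne.symm hij]
  have hlen := hperm.length_eq
  rw [List.length_append, List.length_replicate] at hlen
  have hl'n : ∀ i ∈ l', n < i := fun i hi =>
    hJn i (hlJ i (hperm.mem_iff.mpr (List.mem_append_left _ hi)))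
  have h1 := word_perm (w := w) hn hD hperm N (fun i hi => hJn i (hlJ i hi)) hl.le
  rw [← sub_add_cancel (word D w l) (word D w (l' ++ List.replicate b j))]
  refine add_mem h1 ?_
  rw [word_append, word_replicate]
  -- For `b = 0` the hypothesis places `w` itself in the span of the empty set, so `w = 0`.
  rcases b with _ | b
  · have h0 := hb j hj
    simp only [not_lt_zero, Set.ofPred_false, Set.image_empty, Submodule.span_empty,
      Submodule.mem_bot] at h0
    rw [h0]
    have : ∀ l : List ℤ, word D (0 : V) l = 0 := by
      intro l
      induction l with
      | nil => rfl
      | cons i l ih => rw [word_cons, ih, map_zero]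
    rw [this]
    exact zero_mem _
  · have h2 : (D j ^ (b + 1)) w ∈ filtration D n w b := by
      refine Submodule.span_le.mpr ?_ (hb j hj)
      rintro _ ⟨s, hs, rfl⟩
      have hs : s < b + 1 := hs
      have := word_mem_filtration (l := List.replicate s j) (fun i hi => by
        rw [List.eq_of_mem_replicate hi]; exact hJn j hj) (mem_filtration_zero (D := D) (n := n) (w := w))
      rw [word_replicate, List.length_replicate, zero_add] at this
      exact filtration_mono (by omega) this
    exact filtration_mono (by omega) (word_mem_filtration hl'n h2)

end

/-- `f` acts locally finitely. -/
def LocallyFinite (f : Module.End ℂ V) : Prop :=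
  ∀ v : V, ∃ W : Submodule ℂ V, v ∈ W ∧ FiniteDimensional ℂ W ∧ ∀ u ∈ W, f u ∈ W

/-- Cayley–Hamilton on a stable finite-dimensional subspace, with the characteristic polynomial
multiplied by a power of `X`. Having all `b ≥ b₀` lets one exponent serve finitely many operators.
-/
theorem LocallyFinite.exists_pow_mem_span {f : Module.End ℂ V} (hf : LocallyFinite f) (w : V) :
    ∃ b₀ : ℕ, ∀ b ≥ b₀, (f ^ b) w ∈ Submodule.span ℂ ((fun s => (f ^ s) w) '' {s | s < b}) := by
  obtain ⟨W, hw, hfin, hW⟩ := hf w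
  let g : Module.End ℂ W := f.restrict hW
  have hg : ∀ (s : ℕ) (u : W), ((g ^ s) u : V) = (f ^ s) u := by
    intro s
    induction s with
    | zero => intro u; rfl
    | succ s ih => intro u; rw [pow_succ, pow_succ, Module.End.mul_apply, Module.End.mul_apply, ih]; rfl
  let p : ℂ[X] := LinearMap.charpoly g
  have hp : aeval g p = 0 := LinearMap.aeval_self_charpoly g
  have hm : p.Monic := LinearMap.charpoly_monic g
  refine ⟨p.natDegree, fun b hb => ?_⟩
  have h1 : aeval g (X ^ (b - p.natDegree) * p) ⟨w, hw⟩ = 0 := by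
    rw [map_mul, hp, mul_zero]; rfl
  set q := X ^ (b - p.natDegree) * p with hq
  have hqm : q.Monic := (monic_X_pow _).mul hm
  have hqd : q.natDegree = b := by
    rw [hq, (monic_X_pow _).natDegree_mul hm, natDegree_X_pow]; omega
  have h2 : aeval f q w = 0 := by
    have := congrArg (Subtype.val) h1
    rw [aeval_eq_sum_range] at this ⊢
    simpa [LinearMap.sum_apply, hg] using this
  rw [aeval_eq_sum_range, hqd, Finset.sum_range_succ, LinearMap.add_apply, LinearMap.smul_apply,
    ← hqd, hqm.coeff_natDegree, one_smul, hqd, LinearMap.sum_apply] at h2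
  rw [eq_neg_of_add_eq_zero_right h2]
  refine neg_mem (Submodule.sum_mem _ fun s hs => ?_)
  exact Submodule.smul_mem _ _ (Submodule.subset_span ⟨s, Finset.mem_range.mp hs, rfl⟩)

/-- A vector whose images under the `D i` span a finite-dimensional space generates a
finite-dimensional module, if all the `D i` are locally finite. -/
theorem exists_stable {D : ℤ → Module.End ℂ V} {n : ℤ} (hn : 0 ≤ n) (hD : Relations D n)
    (hlf : ∀ i > n, LocallyFinite (D i)) (w : V)
    (hfg : (Submodule.span ℂ ((fun i => D i w) '' Set.Ioi n)).FG) :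
    ∃ F : Submodule ℂ V, w ∈ F ∧ FiniteDimensional ℂ F ∧ ∀ i > n, ∀ u ∈ F, D i u ∈ F := by
  classical
  obtain ⟨J, hJn, hJ⟩ : ∃ J : Finset ℤ, (∀ j ∈ J, n < j) ∧
      ∀ i > n, D i w ∈ Submodule.span ℂ ((fun j => D j w) '' J) := by
    obtain ⟨t, ht, hspan⟩ := (Submodule.fg_span_iff_fg_span_finset_subset _).mp hfg
    obtain ⟨J, hJ, rfl⟩ := Finset.subset_set_image_iff.mp ht
    refine ⟨J, fun j hj => hJ hj, fun i hi => ?_⟩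
    rw [Finset.coe_image] at hspan
    rw [← hspan]
    exact Submodule.subset_span ⟨i, hi, rfl⟩
  choose b₀ hb₀ using fun j : J => (hlf j (hJn j j.2)).exists_pow_mem_span w
  let b := Finset.univ.sup b₀
  have hb : ∀ j ∈ J, (D j ^ b) w ∈ Submodule.span ℂ ((fun s => (D j ^ s) w) '' {s | s < b}) :=
    fun j hj => hb₀ ⟨j, hj⟩ b (Finset.le_sup (f := b₀) (Finset.mem_univ _))
  refine ⟨filtration D n w (J.card * b), filtration_mono (Nat.zero_le _) mem_filtration_zero,
    Module.Finite.iff_fg.mpr (fg_filtration hn hD hJn hJ _), fun i hi u hu => ?_⟩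
  refine (sup_le le_rfl (Submodule.span_le.mpr ?_) :
    filtration D n w (J.card * b) ⊔ Submodule.span ℂ (word D w ''
      {l | l.length = J.card * b + 1 ∧ ∀ i ∈ l, i ∈ J}) ≤ _)
    (filtration_succ_le_words hn hD hJn hJ _ (apply_mem_filtration hi hu))
  rintro _ ⟨l, ⟨hl, hlJ⟩, rfl⟩
  exact word_mem_of_length hn hD hJn hb le_rfl hl hlJ

end WittOperators

/-! ### Locally finite action of the positive part on irreducible modules. -/

namespace Vir

variable {V : Type*} [AddCommGroup V] [Module ℂ V] [LieRingModule Vir V] [LieModule ℂ Vir V]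

theorem lie_d_lie_d (i j : ℤ) (v : V) : ⁅d i, ⁅d j, v⁆⁆ - ⁅d j, ⁅d i, v⁆⁆ =
    ((j : ℂ) - (i : ℂ)) • ⁅d (i + j), v⁆ +
      (if i = -j then ((i : ℂ) ^ 3 - (i : ℂ)) / 12 else 0) • ⁅c, v⁆ := by
  rw [← lie_lie, lie_d_d, dBracket, add_lie, smul_lie, smul_lie]

theorem relations_toEnd {n : ℤ} (hn : 0 ≤ n) :
    WittOperators.Relations (fun i => LieModule.toEnd ℂ Vir V (d i)) n := by
  intro i hi j hj v
  simp only [LieModule.toEnd_apply_apply]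
  rw [lie_d_lie_d, if_neg (by omega), zero_smul, add_zero]

/-- If `d n`, `n > 0`, acts locally finitely and `w` is an eigenvector of `d n`, then the vectors
`d i w` with `i > n` span a finite-dimensional space. -/
theorem fg_span_lie_eigenvector {n : ℤ} (hn : 0 < n) (hlf : ActsLocallyFinitely V n) {w : V} {r : ℂ}
    (hw : ⁅d n, w⁆ = r • w) :
    (Submodule.span ℂ ((fun i => ⁅d i, w⁆) '' Set.Ioi n)).FG := by
  choose W hW hfin hst using hlf
  -- Since `w` is an eigenvector, `[d n, d j] w` lies in any `d n`-stable subspace containing `d j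
  -- w`. As `j > n`, the coefficient `j - n` is nonzero, so `d (n + j) w` lies there too. Thus one
  -- subspace `W` serves a whole residue class modulo `n`.
  have hstep : ∀ j : ℤ, n < j → ∀ s : ℕ, ⁅d (j + s * n), w⁆ ∈ W ⁅d j, w⁆ := by
    intro j hj s
    induction s with
    | zero => simpa using hW ⁅d j, w⁆
    | succ s ih =>
      have hpos : 0 ≤ (s : ℤ) * n := by positivity
      have h1 := lie_d_lie_d n (j + s * n) w
      rw [if_neg (by omega), zero_smul, add_zero, hw, lie_smul] at h1
      have h2 : ((((j + s * n : ℤ) : ℂ)) - (n : ℂ)) ≠ 0 := by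
        rw [sub_ne_zero, Ne, Int.cast_inj]; omega
      have h3 : ⁅d (n + (j + s * n)), w⁆ ∈ W ⁅d j, w⁆ := by
        rw [← Submodule.smul_mem_iff _ h2, ← h1]
        exact sub_mem (hst _ _ ih) (Submodule.smul_mem _ _ ih)
      convert h3 using 3
      push_cast
      ring
  have hle : Submodule.span ℂ ((fun i => ⁅d i, w⁆) '' Set.Ioi n) ≤
      ⨆ j ∈ Finset.Ioc n (2 * n), W ⁅d j, w⁆ := by
    rw [Submodule.span_le]
    rintro _ ⟨i, hi, rfl⟩
    have hi : n < i := hi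
    set j := n + 1 + (i - n - 1) % n with hj
    have h1 := Int.emod_nonneg (i - n - 1) hn.ne'
    have h2 := Int.emod_lt_of_pos (i - n - 1) hn
    have h3 := Int.mul_ediv_add_emod (i - n - 1) n
    have h4 : 0 ≤ (i - n - 1) / n := Int.ediv_nonneg (by omega) hn.le
    obtain ⟨s, hs⟩ := Int.eq_ofNat_of_zero_le h4
    refine Submodule.mem_iSup_of_mem j (Submodule.mem_iSup_of_mem
      (Finset.mem_Ioc.mpr ⟨by omega, by omega⟩) ?_)
    have h5 := hstep j (by omega) s
    have h6 : j + s * n = i := by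
      rw [hs] at h3
      linarith
    rwa [h6] at h5
  have hfg : (⨆ j ∈ Finset.Ioc n (2 * n), W ⁅d j, w⁆).FG :=
    Submodule.fg_biSup _ _ fun j _ => Module.Finite.iff_fg.mp (hfin _)
  have : FiniteDimensional ℂ ↥(⨆ j ∈ Finset.Ioc n (2 * n), W ⁅d j, w⁆) :=
    Module.Finite.iff_fg.mpr hfg
  exact Module.Finite.iff_fg.mp (Submodule.finiteDimensional_of_le hle)

theorem exists_eigenvector [Nontrivial V] {n : ℤ} (hlf : ActsLocallyFinitely V n) :
    ∃ w : V, w ≠ 0 ∧ ∃ r : ℂ, ⁅d n, w⁆ = r • w := by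
  obtain ⟨v, hv⟩ := exists_ne (0 : V)
  obtain ⟨W, hvW, hfin, hW⟩ := hlf v
  have : Nontrivial W := ⟨⟨v, hvW⟩, 0, fun h => hv (congrArg Subtype.val h)⟩
  obtain ⟨r, hr⟩ := Module.End.exists_eigenvalue
    (LinearMap.restrict (LieModule.toEnd ℂ Vir V (d n)) hW)
  obtain ⟨w, hw⟩ := hr.exists_hasEigenvector
  exact ⟨w, fun h => hw.2 (Subtype.ext h), r, congrArg Subtype.val hw.apply_eq_smul⟩

variable (V) in
/-- The vectors annihilated by almost all `d k`, `k > 0`. -/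
def eventuallyKilled : LieSubmodule ℂ Vir V where
  carrier := {v | ∃ N : ℤ, ∀ k ≥ N, ⁅d k, v⁆ = 0}
  zero_mem' := ⟨0, fun k _ => lie_zero _⟩
  add_mem' := by
    rintro u v ⟨N, hN⟩ ⟨N', hN'⟩
    refine ⟨max N N', fun k hk => ?_⟩
    rw [lie_add, hN k (by omega), hN' k (by omega), add_zero]
  smul_mem' := by
    rintro r u ⟨N, hN⟩
    exact ⟨N, fun k hk => by rw [lie_smul, hN k hk, smul_zero]⟩
  lie_mem := by
    rintro x v ⟨N, hN⟩
    change ∃ N : ℤ, ∀ k ≥ N, ⁅d k, ⁅x, v⁆⁆ = 0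
    induction x using induction_on with
    | hc =>
      refine ⟨N, fun k hk => ?_⟩
      rw [leibniz_lie, lie_c_right, hN k hk, zero_lie, lie_zero, add_zero]
    | hd i =>
      -- The bound `1 - i` excludes `k = -i`, where the central element would contribute.
      refine ⟨max (max N (N - i)) (1 - i), fun k hk => ?_⟩
      have := lie_d_lie_d k i v
      rwa [hN k (by omega), lie_zero, sub_zero, hN (k + i) (by omega), smul_zero, zero_add,
        if_neg (by omega), zero_smul] at this
    | hadd x y hx hy =>
      obtain ⟨N₁, h₁⟩ := hx
      obtain ⟨N₂, h₂⟩ := hy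
      refine ⟨max N₁ N₂, fun k hk => ?_⟩
      rw [add_lie, lie_add, h₁ k (by omega), h₂ k (by omega), add_zero]
    | hsmul r x hx =>
      obtain ⟨N₁, h₁⟩ := hx
      exact ⟨N₁, fun k hk => by rw [smul_lie, lie_smul, h₁ k hk, smul_zero]⟩

/-- On an irreducible module on which almost all `d k`, `k > 0`, act locally finitely, every vector
is annihilated by almost all `d k`, `k > 0`. -/
theorem exists_forall_lie_eq_zero (hirr : LieModule.IsIrreducible ℂ Vir V) {K : ℤ}
    (hK : ∀ k > K, ActsLocallyFinitely V k) (v : V) : ∃ N : ℤ, ∀ k ≥ N, ⁅d k, v⁆ = 0 := by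
  have : Nontrivial V := LieModule.nontrivial_of_isIrreducible ℂ Vir V
  -- This `n` is positive, and `d i` is locally finite for all `i ≥ n`.
  set n := max K 0 + 1 with hn
  obtain ⟨w, hw0, r, hw⟩ := exists_eigenvector (hK n (by omega))
  obtain ⟨F, hwF, hfin, hF⟩ := WittOperators.exists_stable (by omega)
    (relations_toEnd (V := V) (n := n) (by omega)) (fun i hi => hK i (by omega)) w
    (fg_span_lie_eigenvector (by omega) (hK n (by omega)) hw)
  -- The value `0` for `i ≤ n` is a filler: the relations only involve indices above `n`.
  let D : ℤ → Module.End ℂ F := fun i =>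
    if h : n < i then LinearMap.restrict (LieModule.toEnd ℂ Vir V (d i)) (hF i h) else 0
  have hDv : ∀ i, n < i → ∀ u : F, (D i u : V) = ⁅d i, (u : V)⁆ := by
    intro i hi u
    simp only [D, dif_pos hi]
    rfl
  obtain ⟨N, hN⟩ := WittOperators.eventually_zero (D := D) (n := n) (by omega) (by
    intro i hi j hj u
    refine Subtype.ext ?_
    have := relations_toEnd (V := V) (n := n) (by omega) i hi j hj u
    simpa [hDv i hi, hDv j hj, hDv (i + j) (by omega)] using this)
  have hmem : w ∈ eventuallyKilled V := by
    refine ⟨max N (n + 1), fun k hk => ?_⟩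
    have := congrArg Subtype.val (LinearMap.congr_fun (hN k (by omega)) ⟨w, hwF⟩)
    rwa [hDv k (by omega)] at this
  have htop : eventuallyKilled V = ⊤ := (hirr.eq_bot_or_eq_top _).resolve_left
    fun h => hw0 (by rwa [h, LieSubmodule.mem_bot] at hmem)
  have : v ∈ eventuallyKilled V := htop ▸ LieSubmodule.mem_top v
  exact this

end Vir

/-! ### Exponential polynomials with values in a vector space -/

section ExpPoly

variable {T T' : Type*} [AddCommGroup T] [Module ℂ T] [AddCommGroup T'] [Module ℂ T']

variable (T) in
/-- The shift `f ↦ f (· + 1)` of sequences indexed by an additive monoid with one. -/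
def seqShift (A : Type*) [Add A] [One A] : Module.End ℂ (A → T) :=
  LinearMap.funLeft ℂ T (fun k : A => k + 1)

theorem seqShift_apply {A : Type*} [Add A] [One A] (f : A → T) (k : A) :
    seqShift T A f k = f (k + 1) := rfl

/-- `f k = γ ^ k • p k` with `p` polynomial, expressed through the shift operator. -/
def IsExpPoly (γ : ℂ) (f : ℤ → T) : Prop :=
  f ∈ (seqShift T ℤ).maxGenEigenspace γ

theorem isExpPoly_iff {γ : ℂ} {f : ℤ → T} :
    IsExpPoly γ f ↔ ∃ n : ℕ, ((seqShift T ℤ - γ • (1 : Module.End ℂ (ℤ → T))) ^ n) f = 0 := by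
  rw [IsExpPoly, Module.End.mem_maxGenEigenspace]

namespace IsExpPoly

variable {γ : ℂ} {f g : ℤ → T}

theorem zero : IsExpPoly γ (0 : ℤ → T) := zero_mem _

theorem add (hf : IsExpPoly γ f) (hg : IsExpPoly γ g) : IsExpPoly γ (f + g) := add_mem hf hg

theorem sub (hf : IsExpPoly γ f) (hg : IsExpPoly γ g) : IsExpPoly γ (f - g) := sub_mem hf hg

theorem sum {ι : Type*} {s : Finset ι} {f : ι → ℤ → T} (h : ∀ i ∈ s, IsExpPoly γ (f i)) :
    IsExpPoly γ (∑ i ∈ s, f i) := sum_mem h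

theorem map (hf : IsExpPoly γ f) (φ : T →ₗ[ℂ] T') : IsExpPoly γ (fun k => φ (f k)) := by
  rw [isExpPoly_iff] at hf ⊢
  obtain ⟨n, hn⟩ := hf
  refine ⟨n, ?_⟩
  have key : ∀ (n : ℕ) (f : ℤ → T),
      ((seqShift T' ℤ - γ • (1 : Module.End ℂ (ℤ → T'))) ^ n) (fun k => φ (f k)) =
        fun k => φ (((seqShift T ℤ - γ • (1 : Module.End ℂ (ℤ → T))) ^ n) f k) := by
    intro n
    induction n with
    | zero => intro f; rfl
    | succ n ih =>
      intro f
      rw [pow_succ, pow_succ, Module.End.mul_apply, Module.End.mul_apply, ← ih]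
      congr 1
      funext k
      simp [seqShift_apply]
  rw [key, hn]
  funext k
  simp

/-- An exponential polynomial is determined by its values at large integers. -/
theorem eq_zero_of_eventually (hf : IsExpPoly γ f) (hγ : γ ≠ 0) {N : ℤ} (h : ∀ k ≥ N, f k = 0) :
    f = 0 := by
  obtain ⟨n, hn⟩ := isExpPoly_iff.mp hf
  clear hf
  induction n generalizing f with
  | zero => simpa using hn
  | succ n ih =>
    rw [pow_succ, Module.End.mul_apply] at hn
    -- The induction hypothesis for `(S - γ) f`, with `S` the shift, reduces to `f (k + 1) = γ • f
    -- k`; as `γ ≠ 0`, zeros propagate downwards.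
    have h1 := ih (fun k hk => by simp [seqShift_apply, h k hk, h (k + 1) (by omega)]) hn
    have h2 : ∀ k, f (k + 1) = γ • f k := by
      intro k
      have := congrFun h1 k
      simpa [seqShift_apply, sub_eq_zero] using this
    have h3 : ∀ m : ℕ, f (N - m) = 0 := by
      intro m
      induction m with
      | zero => exact h _ (by simp)
      | succ m ihm =>
        have := h2 (N - (m + 1 : ℕ))
        rw [show N - ((m + 1 : ℕ) : ℤ) + 1 = N - m by push_cast; ring, ihm] at this
        exact (smul_eq_zero.mp this.symm).resolve_left hγ
    funext k
    rcases le_total N k with hk | hk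
    · exact h k hk
    · have := h3 (N - k).toNat
      rwa [Int.toNat_of_nonneg (by omega), sub_sub_cancel] at this

/-- Exponential polynomials with different bases are linearly independent, even if only their
values at large integers are considered. -/
theorem eq_zero_of_sum_eventually {s : Finset ℂˣ} {f : ℂˣ → ℤ → T}
    (hf : ∀ γ ∈ s, IsExpPoly (γ : ℂ) (f γ)) {N : ℤ} (h : ∀ k ≥ N, ∑ γ ∈ s, f γ k = 0) :
    ∀ γ ∈ s, f γ = 0 := by
  -- Restriction to `[N, ∞)` commutes with the shift, and there the sum vanishes identically. So
  -- independence of generalized eigenspaces of the shift on `ℕ → T` applies.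
  let r : (ℤ → T) →ₗ[ℂ] (ℕ → T) := LinearMap.funLeft ℂ T (fun k : ℕ => N + (k : ℤ))
  have hr : ∀ γ ∈ s, r (f γ) ∈ (seqShift T ℕ).maxGenEigenspace (γ : ℂ) := by
    intro γ hγ
    obtain ⟨n, hn⟩ := isExpPoly_iff.mp (hf γ hγ)
    rw [Module.End.mem_maxGenEigenspace]
    refine ⟨n, ?_⟩
    have key : ∀ (n : ℕ) (f : ℤ → T),
        ((seqShift T ℕ - (γ : ℂ) • (1 : Module.End ℂ (ℕ → T))) ^ n) (r f) =
          r (((seqShift T ℤ - (γ : ℂ) • (1 : Module.End ℂ (ℤ → T))) ^ n) f) := by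
      intro n
      induction n with
      | zero => intro f; rfl
      | succ n ih =>
        intro f
        rw [pow_succ, pow_succ, Module.End.mul_apply, Module.End.mul_apply, ← ih]
        congr 1
        funext k
        simp [seqShift_apply, r, LinearMap.funLeft_apply, add_assoc]
    rw [key, hn, map_zero]
  have hind := ((seqShift T ℕ).independent_maxGenEigenspace.comp
    (Units.val_injective : Function.Injective (Units.val : ℂˣ → ℂ)))
  have hsum : ∑ γ ∈ s, r (f γ) = 0 := by
    funext k
    rw [Finset.sum_apply]
    exact h (N + k) (by omega)
  intro γ hγ
  have hrz : r (f γ) = 0 :=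
    (iSupIndep_iff_finsetSum_eq_zero_imp_eq_zero _).mp hind s (fun γ => r (f γ)) hr hsum γ hγ
  refine (hf γ hγ).eq_zero_of_eventually γ.ne_zero (N := N) fun k hk => ?_
  have := congrFun hrz (k - N).toNat
  rw [LinearMap.funLeft_apply, Int.toNat_of_nonneg (by omega), add_sub_cancel] at this
  exact this

/-- Conjugation by multiplication with `γ ^ k` carries `γ (S - 1)` to `S - γ`, where `S` is the
shift. -/
theorem zpow_smul {γ : ℂˣ} (hf : IsExpPoly 1 f) :
    IsExpPoly (γ : ℂ) (fun k => ((γ ^ k : ℂˣ) : ℂ) • f k) := by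
  obtain ⟨n, hn⟩ := isExpPoly_iff.mp hf
  refine isExpPoly_iff.mpr ⟨n, ?_⟩
  have key : ∀ (n : ℕ) (f : ℤ → T),
      ((seqShift T ℤ - (γ : ℂ) • (1 : Module.End ℂ (ℤ → T))) ^ n)
        (fun k => ((γ ^ k : ℂˣ) : ℂ) • f k) =
      fun k => ((γ ^ k : ℂˣ) : ℂ) • (γ : ℂ) ^ n •
        (((seqShift T ℤ - (1 : ℂ) • (1 : Module.End ℂ (ℤ → T))) ^ n) f k) := by
    intro n
    induction n with
    | zero => intro f; simp
    | succ n ih =>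
      intro f
      rw [pow_succ, pow_succ, pow_succ, Module.End.mul_apply, Module.End.mul_apply]
      have e : (seqShift T ℤ - (γ : ℂ) • (1 : Module.End ℂ (ℤ → T)))
          (fun k => ((γ ^ k : ℂˣ) : ℂ) • f k) = fun k => ((γ ^ k : ℂˣ) : ℂ) •
            ((γ : ℂ) • (seqShift T ℤ - (1 : ℂ) • (1 : Module.End ℂ (ℤ → T))) f) k := by
        funext k
        simp [seqShift_apply, zpow_add_one₀, smul_sub, smul_smul, mul_comm]
      rw [e, ih]
      funext k
      rw [map_smul, Pi.smul_apply, mul_smul]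
  rw [key, hn]
  funext k
  simp

/-- The difference operator of order `r + 1` annihilates `k ^ r`. -/
theorem pow_smul_const (r : ℕ) (m : T) : IsExpPoly (1 : ℂ) (fun k : ℤ => (k : ℂ) ^ r • m) := by
  have h : IsExpPoly (1 : ℂ) (fun k : ℤ => (k : ℂ) ^ r) := by
    refine isExpPoly_iff.mpr ⟨r + 1, ?_⟩
    have key : ∀ (n : ℕ) (f : ℤ → ℂ),
        ((seqShift ℂ ℤ - (1 : ℂ) • (1 : Module.End ℂ (ℤ → ℂ))) ^ n) f = (fwdDiff 1)^[n] f := by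
      intro n
      induction n with
      | zero => intro f; rfl
      | succ n ih =>
        intro f
        rw [pow_succ, Module.End.mul_apply, ih, Function.iterate_succ_apply]
        congr 1
        funext k
        simp [seqShift_apply, fwdDiff]
    rw [key]
    have := fwdDiff_iter_pow_eq_zero_of_lt (R := ℂ) (Nat.lt_succ_self r)
    funext k
    have h2 : ∀ (n : ℕ) (f : ℂ → ℂ) (k : ℤ), (fwdDiff 1)^[n] (fun k : ℤ => f k) k =
        (fwdDiff 1)^[n] f (k : ℂ) := by
      intro n
      induction n with
      | zero => intro f k; rfl
      | succ n ih =>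
        intro f k
        rw [Function.iterate_succ_apply, Function.iterate_succ_apply, ← ih]
        have e : (fwdDiff 1 fun k : ℤ => f k) = fun k : ℤ => fwdDiff 1 f (k : ℂ) := by
          funext j
          simp [fwdDiff]
        rw [e]
    rw [h2 (r + 1) (fun x => x ^ r), this]
    rfl
  simpa using h.map ((LinearMap.toSpanSingleton ℂ T m))

end IsExpPoly

end ExpPoly

/-! ### Separation of the tensor factors by their exponential bases. -/

section Intertwine

variable {T T' : Type*} [AddCommGroup T] [Module ℂ T] [AddCommGroup T'] [Module ℂ T']

/-- A linear map which intertwines two sums of families of operators depending exponentially on `k`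
with pairwise different bases, up to operators vanishing for large `k`, intertwines the families
with the same base and annihilates the other ones. -/
theorem intertwine_of_sum {I I' : Type*} [Fintype I] [Fintype I'] {γ : I → ℂˣ} {γ' : I' → ℂˣ}
    (hγ : Function.Injective γ) (hγ' : Function.Injective γ')
    {E : I → ℤ → Module.End ℂ T} {E' : I' → ℤ → Module.End ℂ T'}
    {G : ℤ → Module.End ℂ T} {G' : ℤ → Module.End ℂ T'}
    (hE : ∀ i x, IsExpPoly (γ i : ℂ) (fun k => E i k x))
    (hE' : ∀ i x, IsExpPoly (γ' i : ℂ) (fun k => E' i k x))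
    (hG : ∀ x, ∃ N : ℤ, ∀ k ≥ N, G k x = 0) (hG' : ∀ x, ∃ N : ℤ, ∀ k ≥ N, G' k x = 0)
    (φ : T →ₗ[ℂ] T')
    (hφ : ∀ k x, φ (∑ i, E i k x + G k x) = ∑ i, E' i k (φ x) + G' k (φ x)) :
    (∀ i i', γ i = γ' i' → ∀ k x, φ (E i k x) = E' i' k (φ x)) ∧
      (∀ i, (∀ i', γ' i' ≠ γ i) → ∀ k x, φ (E i k x) = 0) ∧
      ∀ k x, φ (G k x) = G' k (φ x) := by
  classical
  -- The part of base `c` of the failure of `φ` to intertwine. The sum over all `c` equals the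
  -- difference of the `G` terms, hence vanishes for large `k`, so each `f x c` is zero for all `k`.
  let f : T → ℂˣ → ℤ → T' := fun x c =>
    (∑ i with γ i = c, fun k => φ (E i k x)) - ∑ i' with γ' i' = c, fun k => E' i' k (φ x)
  let s : Finset ℂˣ := Finset.univ.image γ ∪ Finset.univ.image γ'
  have hsum : ∀ x k, ∑ c ∈ s, f x c k = G' k (φ x) - φ (G k x) := by
    intro x k
    have h1 := hφ k x
    rw [map_add, map_sum] at h1
    simp only [f, Pi.sub_apply, Finset.sum_apply, Finset.sum_sub_distrib]
    rw [Finset.sum_fiberwise_of_maps_to (fun i _ => Finset.mem_union_left _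
        (Finset.mem_image_of_mem γ (Finset.mem_univ i))),
      Finset.sum_fiberwise_of_maps_to (fun i _ => Finset.mem_union_right _
        (Finset.mem_image_of_mem γ' (Finset.mem_univ i))), sub_eq_sub_iff_add_eq_add, h1, add_comm]
  have hf : ∀ x, ∀ c ∈ s, f x c = 0 := by
    intro x
    obtain ⟨N, hN⟩ := hG x
    obtain ⟨N', hN'⟩ := hG' (φ x)
    refine IsExpPoly.eq_zero_of_sum_eventually (N := max N N') (fun c _ => ?_) fun k hk => ?_
    · refine IsExpPoly.sub (IsExpPoly.sum fun i hi => ?_) (IsExpPoly.sum fun i' hi' => ?_)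
      · rw [← (Finset.mem_filter.mp hi).2]
        exact (hE i x).map φ
      · rw [← (Finset.mem_filter.mp hi').2]
        exact hE' i' (φ x)
    · rw [hsum, hN k (by omega), hN' k (by omega), map_zero, sub_zero]
  have hmem : ∀ i, γ i ∈ s := fun i =>
    Finset.mem_union_left _ (Finset.mem_image_of_mem γ (Finset.mem_univ i))
  refine ⟨fun i i' h k x => ?_, fun i h k x => ?_, fun k x => ?_⟩
  · have h1 := congrFun (hf x _ (hmem i)) k
    have h2 : (Finset.univ.filter fun j => γ j = γ i) = {i} := by
      ext j; simp [hγ.eq_iff]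
    have h3 : (Finset.univ.filter fun j => γ' j = γ i) = {i'} := by
      ext j; simp [h, hγ'.eq_iff]
    simp only [f, h2, h3, Finset.sum_singleton, Pi.sub_apply, Pi.zero_apply] at h1
    exact sub_eq_zero.mp h1
  · have h1 := congrFun (hf x _ (hmem i)) k
    have h2 : (Finset.univ.filter fun j => γ j = γ i) = {i} := by
      ext j; simp [hγ.eq_iff]
    have h3 : (Finset.univ.filter fun j => γ' j = γ i) = ∅ := by
      ext j; simp [h]
    simpa only [f, h2, h3, Finset.sum_singleton, Finset.sum_empty, sub_zero, Pi.zero_apply] using h1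
  · have h1 := hsum x k
    rw [Finset.sum_eq_zero fun c hc => by rw [hf x c hc]; rfl] at h1
    exact (sub_eq_zero.mp h1.symm).symm

end Intertwine

/-! ### Sums of copies of a module -/

/-- The space `T` with operators `σ` is a direct sum of copies of `M` with operators `ρ`, in the
sense that the intertwining maps `M → T` generate `T` and the intertwining maps `T → M` separate
the points of `T`. -/
structure IsSumOfCopies {κ M T : Type*} [AddCommGroup M] [Module ℂ M] [AddCommGroup T] [Module ℂ T]
    (ρ : κ → Module.End ℂ M) (σ : κ → Module.End ℂ T) : Prop where
  generating : ∀ S : Submodule ℂ T, (∀ f : M →ₗ[ℂ] T, (∀ a u, f (ρ a u) = σ a (f u)) →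
    ∀ u, f u ∈ S) → ∀ x, x ∈ S
  separating : ∀ x : T, x ≠ 0 → ∃ g : T →ₗ[ℂ] M, (∀ a y, g (σ a y) = ρ a (g y)) ∧ g x ≠ 0

namespace IsSumOfCopies

variable {κ M T M' T' : Type*} [AddCommGroup M] [Module ℂ M] [AddCommGroup T] [Module ℂ T]
  [AddCommGroup M'] [Module ℂ M'] [AddCommGroup T'] [Module ℂ T']
  {ρ : κ → Module.End ℂ M} {σ : κ → Module.End ℂ T}
  {ρ' : κ → Module.End ℂ M'} {σ' : κ → Module.End ℂ T'}

theorem refl (ρ : κ → Module.End ℂ M) : IsSumOfCopies ρ ρ where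
  generating _ h x := h LinearMap.id (fun _ _ => rfl) x
  separating _ hx := ⟨LinearMap.id, fun _ _ => rfl, hx⟩

theorem comp_index {κ' : Type*} (h : IsSumOfCopies ρ σ) (e : κ' → κ) :
    IsSumOfCopies (fun a => ρ (e a)) (fun a => σ (e a)) where
  generating S hS x := h.generating S (fun f hf u => hS f (fun a u => hf (e a) u) u) x
  separating x hx := by
    obtain ⟨g, hg, hgx⟩ := h.separating x hx
    exact ⟨g, fun a y => hg (e a) y, hgx⟩

theorem congr (h : IsSumOfCopies ρ σ) (e : T ≃ₗ[ℂ] T') (he : ∀ a x, e (σ a x) = σ' a (e x)) :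
    IsSumOfCopies ρ σ' where
  generating S hS x := by
    have := h.generating (S.comap e.toLinearMap) (fun f hf u =>
      hS (e.toLinearMap ∘ₗ f) (fun a u => by simp [hf, he]) u) (e.symm x)
    simpa using this
  separating x hx := by
    obtain ⟨g, hg, hgx⟩ := h.separating (e.symm x) (by simpa using hx)
    refine ⟨g ∘ₗ e.symm.toLinearMap, fun a y => ?_, hgx⟩
    have : e.symm (σ' a y) = σ a (e.symm y) := by
      rw [LinearEquiv.symm_apply_eq, he, LinearEquiv.apply_symm_apply]
    simp [this, hg]

/-- A basis of `B` would split `T ⊗ B` into copies of `T`; here pure tensors generate, and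
functionals on `B` separate. -/
theorem rTensor (h : IsSumOfCopies ρ σ) (B : Type*) [AddCommGroup B] [Module ℂ B] :
    IsSumOfCopies ρ (fun a => (σ a).rTensor B) where
  generating S hS x := by
    have key : ∀ (t : T) (b : B), t ⊗ₜ[ℂ] b ∈ S := fun t b =>
      h.generating (S.comap ((TensorProduct.mk ℂ T B).flip b)) (fun f hf u =>
        hS ((TensorProduct.mk ℂ T B).flip b ∘ₗ f) (fun a u => by simp [hf]) u) t
    induction x using TensorProduct.induction_on with
    | zero => exact zero_mem _
    | tmul t b => exact key t b
    | add x y hx hy => exact add_mem hx hy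
  separating x hx := by
    classical
    obtain ⟨ζ, hζ⟩ : ∃ ζ : B →ₗ[ℂ] ℂ, TensorProduct.rid ℂ T (ζ.lTensor T x) ≠ 0 := by
      by_contra! hcon
      refine hx ((TensorProduct.equivFinsuppOfBasisRight (M := T)
        (Module.Basis.ofVectorSpace ℂ B)).injective ?_)
      rw [map_zero]
      ext i
      rw [Finsupp.zero_apply, TensorProduct.equivFinsuppOfBasisRight_apply]
      exact hcon _
    obtain ⟨g, hg, hgx⟩ := h.separating _ hζ
    refine ⟨g ∘ₗ (TensorProduct.rid ℂ T).toLinearMap ∘ₗ ζ.lTensor T, fun a y => ?_, hgx⟩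
    induction y using TensorProduct.induction_on with
    | zero => simp
    | tmul t b => simp [hg]
    | add y z hy hz => simp only [map_add, hy, hz]

theorem lTensor (h : IsSumOfCopies ρ σ) (B : Type*) [AddCommGroup B] [Module ℂ B] :
    IsSumOfCopies ρ (fun a => (σ a).lTensor B) :=
  (h.rTensor B).congr (TensorProduct.comm ℂ T B) fun a x => by
    induction x using TensorProduct.induction_on with
    | zero => simp
    | tmul t b => simp
    | add y z hy hz => simp only [map_add, hy, hz]

/-- Some composite `M → T → T' → M'` is nonzero: otherwise `φ` would vanish on the images of all
maps `M → T`, which generate `T`, because the maps `T' → M'` detect nonzero vectors. -/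
theorem exists_intertwiner (h : IsSumOfCopies ρ σ) (h' : IsSumOfCopies ρ' σ') (φ : T →ₗ[ℂ] T')
    (hφ : φ ≠ 0) (hσ : ∀ a x, φ (σ a x) = σ' a (φ x)) :
    ∃ ψ : M →ₗ[ℂ] M', ψ ≠ 0 ∧ ∀ a u, ψ (ρ a u) = ρ' a (ψ u) := by
  obtain ⟨f, hf, u, hu⟩ : ∃ f : M →ₗ[ℂ] T, (∀ a u, f (ρ a u) = σ a (f u)) ∧ ∃ u, φ (f u) ≠ 0 := by
    by_contra! hcon
    exact hφ (LinearMap.ext fun x => h.generating (LinearMap.ker φ) (fun f hf u => hcon f hf u) x)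
  obtain ⟨g, hg, hgx⟩ := h'.separating _ hu
  exact ⟨g ∘ₗ φ ∘ₗ f, fun h0 => hgx (LinearMap.congr_fun h0 u), fun a u => by simp [hf, hσ, hg]⟩

/-- The vectors with this property form a subspace that contains the image of every intertwining map
from `M`. The same argument proves `eventually_zero`. -/
theorem isExpPoly {ρ : ℤ → Module.End ℂ M} {σ : ℤ → Module.End ℂ T} (h : IsSumOfCopies ρ σ) {γ : ℂ}
    (hρ : ∀ u, IsExpPoly γ (fun k => ρ k u)) (x : T) : IsExpPoly γ (fun k => σ k x) := by
  let S : Submodule ℂ T :=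
    { carrier := {x | IsExpPoly γ (fun k => σ k x)}
      zero_mem' := by
        have : (fun k => σ k (0 : T)) = 0 := by funext k; simp
        rw [Set.mem_ofPred_eq, this]
        exact IsExpPoly.zero
      add_mem' := fun {x y} hx hy => by
        have : (fun k => σ k (x + y)) = (fun k => σ k x) + fun k => σ k y := by
          funext k; simp
        rw [Set.mem_ofPred_eq, this]
        exact IsExpPoly.add hx hy
      smul_mem' := fun r x hx => by
        have := IsExpPoly.map hx (r • LinearMap.id)
        simpa using this }
  exact h.generating S (fun f hf u => by
    have := (hρ u).map f
    simp only [hf] at this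
    exact this) x

theorem eventually_zero {ρ : ℤ → Module.End ℂ M} {σ : ℤ → Module.End ℂ T} (h : IsSumOfCopies ρ σ)
    (hρ : ∀ u, ∃ N : ℤ, ∀ k ≥ N, ρ k u = 0) (x : T) : ∃ N : ℤ, ∀ k ≥ N, σ k x = 0 := by
  let S : Submodule ℂ T :=
    { carrier := {x | ∃ N : ℤ, ∀ k ≥ N, σ k x = 0}
      zero_mem' := ⟨0, by simp⟩
      add_mem' := by
        rintro x y ⟨N, hN⟩ ⟨N', hN'⟩
        exact ⟨max N N', fun k hk => by rw [map_add, hN k (by omega), hN' k (by omega), add_zero]⟩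
      smul_mem' := by
        rintro r x ⟨N, hN⟩
        exact ⟨N, fun k hk => by rw [map_smul, hN k hk, smul_zero]⟩ }
  exact h.generating S (fun f hf u => by
    obtain ⟨N, hN⟩ := hρ u
    exact ⟨N, fun k hk => by rw [← hf, hN k hk, map_zero]⟩) x

/-- Each tensor factor gives a decomposition of the tensor product as a sum of copies. -/
theorem single {ι : Type*} [hdec : DecidableEq ι] [Fintype ι] {N : ι → Type*} {L : Type*} [LieRing L]
    [LieAlgebra ℂ L] [∀ i, AddCommGroup (N i)] [∀ i, Module ℂ (N i)] [∀ i, LieRingModule L (N i)]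
    [∀ i, LieModule ℂ L (N i)] (i : ι) :
    IsSumOfCopies (fun y : L => LieModule.toEnd ℂ L (N i) y)
      (fun y : L => (PiTensorLie.single i y : Module.End ℂ (⨂[ℂ] j, N j))) where
  generating S hS x := by
    induction x using PiTensorProduct.induction_on with
    | smul_tprod r v =>
      refine S.smul_mem r ?_
      have := hS ((PiTensorProduct.tprod ℂ).toLinearMap v i) (fun y u => by
        simp [PiTensorLie.single_tprod]) (v i)
      simpa using this
    | add x y hx hy => exact add_mem hx hy
  separating x hx := by
    let b := fun j => Module.Basis.ofVectorSpace ℂ (N j)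
    obtain ⟨p, hp⟩ : ∃ p, (Basis.piTensorProduct b).repr x p ≠ 0 := by
      by_contra! hcon
      exact hx ((Basis.piTensorProduct b).repr.injective (by rw [map_zero]; ext p; exact hcon p))
    have hi : ∀ (v : ∀ j, N j) (z : N i),
        ∏ j ∈ Finset.univ.erase i, (b j).repr (Function.update v i z j) (p j) =
          ∏ j ∈ Finset.univ.erase i, (b j).repr (v j) (p j) := fun v z =>
      Finset.prod_congr rfl fun j hj => by rw [Function.update_of_ne (Finset.ne_of_mem_erase hj)]
    have hk : ∀ (v : ∀ j, N j) (k : ι) (_ : k ≠ i) (z : N k),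
        ∏ j ∈ Finset.univ.erase i, (b j).repr (Function.update v k z j) (p j) =
          (b k).repr z (p k) *
            ∏ j ∈ (Finset.univ.erase i).erase k, (b j).repr (v j) (p j) := fun v k hk z => by
      rw [← Finset.mul_prod_erase _ _ (Finset.mem_erase.mpr ⟨hk, Finset.mem_univ k⟩),
        Function.update_self]
      congr 1
      exact Finset.prod_congr rfl fun j hj => by
        rw [Function.update_of_ne (Finset.ne_of_mem_erase hj)]
    -- Contraction of all factors except the `i`-th with the coordinate functionals of the index
    -- `p`. The `p i`-th coordinate of the contraction of `x` is the `p`-th coordinate of `x`, which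
    -- is nonzero.
    let c : MultilinearMap ℂ N (N i) :=
      { toFun := fun v => (∏ j ∈ Finset.univ.erase i, (b j).repr (v j) (p j)) • v i
        map_update_add' := by
          intro inst v k x y
          have e : hdec = inst := Subsingleton.elim _ _
          subst e
          by_cases h : k = i
          · subst h
            simp only [hi, Function.update_self, smul_add]
          · simp only [hk v k h, Function.update_of_ne (Ne.symm h), map_add, Finsupp.add_apply,
              add_mul, add_smul]
        map_update_smul' := by
          intro inst v k r x
          have e : hdec = inst := Subsingleton.elim _ _
          subst e
          by_cases h : k = i
          · subst h
            simp only [hi, Function.update_self, smul_comm r]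
          · simp only [hk v k h, Function.update_of_ne (Ne.symm h), map_smul, Finsupp.smul_apply,
              smul_eq_mul, mul_assoc, mul_smul] }
    refine ⟨PiTensorProduct.lift c, fun y z => ?_, fun h0 => hp ?_⟩
    · induction z using PiTensorProduct.induction_on with
      | smul_tprod r v =>
        rw [map_smul, map_smul, map_smul, map_smul, PiTensorLie.single_tprod,
          PiTensorProduct.lift.tprod, PiTensorProduct.lift.tprod]
        simp only [c, MultilinearMap.coe_mk, Function.update_self, map_smul,
          LieModule.toEnd_apply_apply]
        congr 2
        refine Finset.prod_congr rfl fun j hj => ?_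
        rw [Function.update_of_ne (Finset.ne_of_mem_erase hj)]
      | add z z' hz hz' => simp only [map_add, hz, hz']
    · have key : (b i).coord (p i) ∘ₗ PiTensorProduct.lift c =
          (Basis.piTensorProduct b).coord p := by
        ext v
        simp only [LinearMap.compMultilinearMap_apply, LinearMap.comp_apply,
          PiTensorProduct.lift.tprod, Module.Basis.coord_apply,
          Basis.piTensorProduct_repr_tprod_apply]
        simp [c, Finset.prod_erase_mul]
      have := LinearMap.congr_fun key x
      rw [LinearMap.comp_apply, h0, map_zero] at this
      exact this.symm

end IsSumOfCopies

/-! ### The modules `Ω(μ, β)` and `Ω(λ, a, t)`: growth of the action and intertwining maps -/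

theorem IsExpPoly.eval {R : Type*} [CommRing R] [Algebra ℂ R] (Q : R[X]) :
    IsExpPoly (1 : ℂ) (fun k : ℤ => Q.eval (algebraMap ℂ R (k : ℂ))) := by
  have : (fun k : ℤ => Q.eval (algebraMap ℂ R (k : ℂ))) =
      ∑ i ∈ Finset.range (Q.natDegree + 1), fun k : ℤ => (k : ℂ) ^ i • Q.coeff i := by
    funext k
    rw [eval_eq_sum_range, Finset.sum_apply]
    refine Finset.sum_congr rfl fun i _ => ?_
    rw [← map_pow, mul_comm, ← Algebra.smul_def]
  rw [this]
  exact IsExpPoly.sum fun i _ => IsExpPoly.pow_smul_const i _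

namespace OmegaOne

variable (mu : ℂˣ) (β β' : ℂ)

theorem isExpPoly_op (f : ℂ[X]) : IsExpPoly (mu : ℂ) (fun k => op mu β k f) := by
  have h : IsExpPoly (1 : ℂ) (fun k : ℤ => f.comp (X - C (k : ℂ)) * (X - C (β * (k : ℂ)))) := by
    -- The outer variable of `ℂ[X][X]` stands for `k`, the inner one for `∂`.
    have e : (fun k : ℤ => f.comp (X - C (k : ℂ)) * (X - C (β * (k : ℂ)))) =
        fun k : ℤ => (f.eval₂ (C.comp C) (C X - X) * (C X - C (C β) * X) : ℂ[X][X]).eval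
          (algebraMap ℂ ℂ[X] (k : ℂ)) := by
      funext k
      rw [algebraMap_eq, eval_mul, ← coe_evalRingHom, hom_eval₂]
      have e1 : (evalRingHom (C (k : ℂ))).comp (C.comp C : ℂ →+* ℂ[X][X]) = C := by
        ext1 r
        simp
      rw [e1]
      simp [comp]
    rw [e]
    exact IsExpPoly.eval _
  simpa only [op_apply] using h.zpow_smul (γ := mu)

variable {mu β β'}

/-- There are no nonzero maps between different `Ω(μ, β)`, `β ≠ 0`, with the same `μ`. -/
theorem eq_of_intertwiner (hβ' : β' ≠ 0) {ψ : ℂ[X] →ₗ[ℂ] ℂ[X]} (hψ0 : ψ ≠ 0)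
    (hψ : ∀ k u, ψ (op mu β k u) = op mu β' k (ψ u)) : β = β' := by
  -- Since `d 0` is multiplication by `∂`, the map `ψ` is `ℂ[∂]`-linear and determined by `ψ 1`.
  have hX : ∀ u, ψ (u * X) = ψ u * X := fun u => by simpa [op_apply] using hψ 0 u
  have hone : ψ 1 ≠ 0 := by
    intro h
    refine hψ0 (LinearMap.ext fun u => ?_)
    have hpow : ∀ n : ℕ, ψ (X ^ n) = 0 := by
      intro n
      induction n with
      | zero => simpa using h
      | succ n ih => rw [pow_succ, hX, ih, zero_mul]
    induction u using Polynomial.induction_on' with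
    | add p q hp hq => rw [map_add, hp, hq, map_add]
    | monomial n r => rw [← C_mul_X_pow_eq_monomial, ← smul_eq_C_mul, map_smul, hpow, smul_zero,
        LinearMap.zero_apply]
  by_contra hne
  have hk : ∀ k : ℤ, ψ 1 * (X - C (β * (k : ℂ))) =
      (ψ 1).comp (X - C (k : ℂ)) * (X - C (β' * (k : ℂ))) := by
    intro k
    have h1 := hψ k 1
    rw [op_apply, op_apply, map_smul] at h1
    have h2 := smul_right_injective ℂ[X] (mu ^ k).ne_zero h1
    simp only [one_comp, one_mul] at h2
    rw [← h2, mul_sub, map_sub]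
    have h3 := hX 1
    rw [one_mul] at h3
    rw [h3, ← mul_one (C (β * (k : ℂ))), ← smul_eq_C_mul, map_smul, smul_eq_C_mul,
      smul_eq_C_mul, mul_one, mul_comm (C _)]
  -- At `∂ = β' k` the right-hand side of `hk` vanishes, and the left-hand factor `(β' - β) k` is
  -- nonzero. As `β' ≠ 0`, this gives infinitely many roots of `ψ 1`.
  have hroot : ∀ k : ℤ, k ≠ 0 → (ψ 1).eval (β' * (k : ℂ)) = 0 := by
    intro k hk0
    have h1 := congrArg (eval (β' * (k : ℂ))) (hk k)
    simp only [eval_mul, eval_sub, eval_X, eval_C, sub_self, mul_zero] at h1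
    refine (mul_eq_zero.mp h1).resolve_right ?_
    rw [← sub_mul]
    exact mul_ne_zero (sub_ne_zero.mpr (Ne.symm hne)) (by exact_mod_cast hk0)
  refine hone (eq_zero_of_infinite_isRoot _ ?_)
  refine Set.Infinite.mono ?_ (Set.infinite_range_of_injective
    (f := fun k : ℕ => β' * (((k : ℤ) + 1 : ℤ) : ℂ)) ?_)
  · rintro _ ⟨k, rfl⟩
    exact hroot (k + 1) (by omega)
  · intro k l h
    have := mul_left_cancel₀ hβ' h
    have : ((k : ℤ) + 1) = l + 1 := by exact_mod_cast this
    omega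

end OmegaOne

namespace OmegaTwo

variable (lam : ℂˣ) (α : ℂ) (h : ℂ[X])

theorem isExpPoly_op (u : ℂ[X][X]) : IsExpPoly (lam : ℂ) (fun k => op lam α h k u) := by
  induction u using Polynomial.induction_on' with
  | add p q hp hq =>
    have := hp.add hq
    simp only [map_add]
    exact this
  | monomial i f =>
    rw [← C_mul_X_pow_eq_monomial, mul_comm]
    simp only [op_apply]
    refine IsExpPoly.zpow_smul ?_
    -- A third polynomial variable, the outermost one, stands for `k`.
    have e : (fun k : ℤ => (X - C (C (k : ℂ))) ^ i * opBase α h k f) =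
        fun k : ℤ => ((C X - X) ^ i *
          ((C X + X * C (C h) - X * (X - 1) * C (C (C α * diffQuot α h))) * C (C f)
            - X * (C (C X) - X * C (C (C α))) * C (C (derivative f)))).eval
          (algebraMap ℂ ℂ[X][X] (k : ℂ)) := by
      funext k
      change (X - C (C (k : ℂ))) ^ i *
        ((X + C (C (k : ℂ) * h - C ((k : ℂ) * ((k : ℂ) - 1) * α) * diffQuot α h)) * C f
          - C (C (k : ℂ) * (X - C ((k : ℂ) * α)) * derivative f)) = _
      simp only [Polynomial.algebraMap_apply, Algebra.algebraMap_self, RingHom.id_apply, eval_mul,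
        eval_pow, eval_sub, eval_add, eval_X, eval_C, eval_one, map_sub, map_mul, map_one]
      generalize C (C (k : ℂ)) = c
      generalize C (C α) = a
      ring
    rw [e]
    exact IsExpPoly.eval _

theorem diffQuot_X : diffQuot α X = 1 := by
  have h1 := diffQuot_spec α (X : ℂ[X])
  rw [eval_X] at h1
  exact mul_left_cancel₀ (X_sub_C_ne_zero α) (h1.trans (mul_one _).symm)

theorem opBase_X (k : ℤ) (f : ℂ[X]) : opBase α X k f =
    X * C f + C ((C (k : ℂ) * X - C ((k : ℂ) * ((k : ℂ) - 1) * α)) * f -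
      C (k : ℂ) * (X - C ((k : ℂ) * α)) * derivative f) := by
  change (X + C (C (k : ℂ) * X - C ((k : ℂ) * ((k : ℂ) - 1) * α) * diffQuot α X)) * C f
      - C (C (k : ℂ) * (X - C ((k : ℂ) * α)) * derivative f) = _
  rw [diffQuot_X, mul_one, C_sub (b := _ * derivative f), C_mul (b := f)]
  generalize C (C (k : ℂ) * (X - C ((k : ℂ) * α)) * derivative f) = q
  generalize C (C (k : ℂ) * X - C ((k : ℂ) * ((k : ℂ) - 1) * α)) = p
  ring

variable {lam α}

/-- Only the coefficients of `∂ ^ e` and `∂ ^ (e - 1)` in `G` contribute. The shift `∂ ↦ ∂ - k`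
enters through the second coefficient of `∂ (∂ - k) ^ e`, which is `-k e`. -/
theorem coeff_op {e : ℕ} (k : ℤ) {G : ℂ[X][X]} (hG : G.natDegree ≤ e) :
    (op lam α X k G).coeff e = ((lam ^ k : ℂˣ) : ℂ) • ((X * G).coeff e +
      (C (-(k : ℂ) * e) + C (k : ℂ) * X - C ((k : ℂ) * ((k : ℂ) - 1) * α)) * G.coeff e -
      C (k : ℂ) * (X - C ((k : ℂ) * α)) * derivative (G.coeff e)) := by
  have hmono : ∀ i ≤ e, ∀ f : ℂ[X], (op lam α X k (X ^ i * C f)).coeff e =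
      ((lam ^ k : ℂˣ) : ℂ) • ((X * (X ^ i * C f)).coeff e +
      (C (-(k : ℂ) * e) + C (k : ℂ) * X - C ((k : ℂ) * ((k : ℂ) - 1) * α)) *
        (X ^ i * C f).coeff e -
      C (k : ℂ) * (X - C ((k : ℂ) * α)) * derivative ((X ^ i * C f).coeff e)) := by
    intro i hi f
    rw [op_apply, coeff_smul, opBase_X]
    congr 1
    generalize hp : C (k : ℂ) * X - C ((k : ℂ) * ((k : ℂ) - 1) * α) = p
    generalize C (k : ℂ) * (X - C ((k : ℂ) * α)) = q
    have e2 : C (-(k : ℂ) * e) + C (k : ℂ) * X - C ((k : ℂ) * ((k : ℂ) - 1) * α) =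
      C (-(k : ℂ) * e) + p := by rw [← hp]; ring
    rw [e2]
    generalize (k : ℂ) = c
    have e1 : (X - C (C c)) ^ i * (X * C f + C (p * f - q * derivative f)) =
        X * ((X - C (C c)) ^ i * C f) + (X - C (C c)) ^ i * C (p * f - q * derivative f) := by
      ring
    have hpow : ∀ j, ((X - C (C c) : ℂ[X][X]) ^ i).coeff j = (-C c) ^ (i - j) * (i.choose j) := by
      intro j
      rw [sub_eq_add_neg, ← C_neg, coeff_X_add_C_pow]
    rw [e1, coeff_add, coeff_mul_C, hpow, coeff_mul_C, coeff_X_pow]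
    rcases e with _ | e
    · obtain rfl : i = 0 := by omega
      simp
    · rw [coeff_X_mul, coeff_X_mul, coeff_mul_C, hpow, coeff_mul_C, coeff_X_pow]
      rcases Nat.lt_or_ge i e with h1 | h1
      · simp [Nat.choose_eq_zero_of_lt h1, Nat.choose_eq_zero_of_lt (h1.trans (Nat.lt_succ_self e)),
          h1.ne', (h1.trans (Nat.lt_succ_self e)).ne']
      · rcases h1.eq_or_lt with rfl | h1
        · simp
        · obtain rfl : i = e + 1 := by omega
          simp
          ring
  rw [G.as_sum_range_C_mul_X_pow' (Nat.lt_succ_of_le hG)]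
  simp only [mul_comm (C _) (X ^ _), map_sum, finsetSum_coeff, Finset.mul_sum, Finset.smul_sum,
    ← Finset.sum_add_distrib, ← Finset.sum_sub_distrib]
  exact Finset.sum_congr rfl fun i hi =>
    hmono i (Nat.lt_succ_iff.mp (Finset.mem_range.mp hi)) _

theorem op_zero (u : ℂ[X][X]) : op lam α X 0 u = X * u := by
  induction u using Polynomial.induction_on' with
  | add p q hp hq => rw [map_add, hp, hq, mul_add]
  | monomial i f =>
    rw [← C_mul_X_pow_eq_monomial, mul_comm, op_apply]
    rw [opBase_X]
    simp only [Int.cast_zero, C_0, sub_zero, zero_mul, add_zero, zpow_zero, Units.val_one,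
      one_smul]
    ring

theorem op_C (k : ℤ) (f : ℂ[X]) : op lam α X k (C f) = ((lam ^ k : ℂˣ) : ℂ) •
    (X * C f + C ((C (k : ℂ) * X - C ((k : ℂ) * ((k : ℂ) - 1) * α)) * f -
      C (k : ℂ) * (X - C ((k : ℂ) * α)) * derivative f)) := by
  have := op_apply lam α X k 0 f
  rw [pow_zero, pow_zero, one_mul, one_mul] at this
  rw [this, opBase_X]

/-- There are no nonzero maps `Ω(λ, β) → Ω(λ, a, t)`. -/
theorem not_intertwiner_omegaOne {β : ℂ} {ψ : ℂ[X] →ₗ[ℂ] ℂ[X][X]} (hψ0 : ψ ≠ 0)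
    (hψ : ∀ k u, ψ (OmegaOne.op lam β k u) = op lam α X k (ψ u)) : False := by
  have hX : ∀ u, ψ (u * X) = X * ψ u := fun u => by
    have := hψ 0 u
    rw [op_zero] at this
    simpa [OmegaOne.op_apply] using this
  have hone : ψ 1 ≠ 0 := by
    intro h
    refine hψ0 (LinearMap.ext fun u => ?_)
    have hpow : ∀ n : ℕ, ψ (X ^ n) = 0 := by
      intro n
      induction n with
      | zero => simpa using h
      | succ n ih => rw [pow_succ, hX, ih, mul_zero]
    induction u using Polynomial.induction_on' with
    | add p q hp hq => rw [map_add, hp, hq, map_add]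
    | monomial n r => rw [← C_mul_X_pow_eq_monomial, ← smul_eq_C_mul, map_smul, hpow, smul_zero,
        LinearMap.zero_apply]
  set G := ψ 1 with hG
  -- For `k = 1` the term `k (k - 1) a` drops out. With `e` the `∂`-degree of `G` and `g` its
  -- leading coefficient, one obtains `(t - (e - β)) g = (t - a) g'`, impossible since `g'` has
  -- smaller degree than `g`.
  have h1 : (ψ (OmegaOne.op lam β 1 1)).coeff G.natDegree =
    (op lam α X 1 G).coeff G.natDegree := by rw [hψ]
  rw [coeff_op 1 le_rfl, OmegaOne.op_apply, map_smul, coeff_smul] at h1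
  have h2 := smul_right_injective ℂ[X] (lam ^ (1 : ℤ)).ne_zero h1
  have h3 := hX 1
  have h4 : ψ (C β) = β • G := by rw [← mul_one (C β), ← smul_eq_C_mul, map_smul]
  rw [one_mul, ← hG] at h3
  simp only [one_comp, one_mul, Int.cast_one, mul_one, map_sub, h3, h4, coeff_sub, coeff_smul] at h2
  have hg : G.coeff G.natDegree ≠ 0 := leadingCoeff_ne_zero.mpr hone
  generalize G.coeff G.natDegree = g at h2 hg
  rw [smul_eq_C_mul] at h2
  have h5 : (X - C ((G.natDegree : ℂ) - β)) * g = (X - C α) * derivative g := by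
    simp only [sub_self, zero_mul, C_0, sub_zero, C_1, one_mul, neg_mul, C_neg, C_sub] at h2 ⊢
    linear_combination -h2
  have h6 := congrArg degree h5
  rw [degree_mul, degree_mul, degree_X_sub_C, degree_X_sub_C] at h6
  have h7 := degree_derivative_lt hg
  have h8 : degree g = degree (derivative g) := by
    rw [degree_eq_natDegree hg] at h6 h7 ⊢
    by_cases hd : derivative g = 0
    · rw [hd, degree_zero] at h6
      exact absurd h6 (by simp)
    · rw [degree_eq_natDegree hd] at h6 ⊢
      norm_cast at h6 ⊢
      omega
  exact h7.ne h8.symm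

/-- There are no nonzero maps between different `Ω(λ, a, t)` with the same `λ`. -/
theorem eq_of_intertwiner {α' : ℂ} {ψ : ℂ[X][X] →ₗ[ℂ] ℂ[X][X]} (hψ0 : ψ ≠ 0)
    (hψ : ∀ k u, ψ (op lam α X k u) = op lam α' X k (ψ u)) : α = α' := by
  have hX : ∀ u, ψ (X * u) = X * ψ u := fun u => by
    have := hψ 0 u
    rwa [op_zero, op_zero] at this
  have hC : ∀ (r : ℂ) u, ψ (C (C r) * u) = C (C r) * ψ u := fun r u => by
    have e : ∀ v : ℂ[X][X], C (C r) * v = r • v := fun v => by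
      rw [← smul_eq_C_mul, ← algebraMap_smul ℂ[X] r v, algebraMap_eq]
    rw [e, e, map_smul]
  have hval : ∀ (k : ℤ) (f : ℂ[X]), X * ψ (C f) + (C (C (k : ℂ)) * ψ (C (X * f)) -
      C (C ((k : ℂ) * ((k : ℂ) - 1) * α)) * ψ (C f) - (C (C (k : ℂ)) * ψ (C (X * derivative f)) -
        C (C ((k : ℂ) * (k * α))) * ψ (C (derivative f)))) =
      ((((lam ^ k)⁻¹ : ℂˣ) : ℂ)) • op lam α' X k (ψ (C f)) := by
    intro k f
    rw [← hψ, op_C, map_smul, smul_smul, Units.inv_mul, one_smul, map_add, hX, ← hC, ← hC, ← hC,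
      ← hC, ← map_sub, ← map_sub, ← map_sub]
    congr 2
    simp only [C_sub, C_mul]
    ring
  -- The relation `hval` with `k = 1` expresses `ψ (t ^ (n + 1))` through `ψ` on lower powers of
  -- `t`, so `ψ 1` determines `ψ` on `ℂ[t]`; linearity over `ℂ[∂]` does the rest.
  have hone : ψ 1 ≠ 0 := by
    intro h0
    have hpow : ∀ n : ℕ, ψ (C (X ^ n)) = 0 := by
      intro n
      induction n using Nat.strong_induction_on with
      | _ n ih =>
        rcases n with _ | n
        · simpa using h0
        · have h1 := hval 1 (X ^ n)
          have h2 : ψ (C (derivative (X ^ n))) = 0 := by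
            rw [derivative_X_pow, C_mul, hC]
            rcases n with _ | n
            · simp
            · rw [ih _ (by omega), mul_zero]
          have h3 : ψ (C (X * derivative (X ^ n))) = 0 := by
            rw [derivative_X_pow]
            rcases n with _ | n
            · simp
            · rw [show X * (C ((n + 1 : ℕ) : ℂ) * X ^ (n + 1 - 1)) =
                C ((n + 1 : ℕ) : ℂ) * X ^ (n + 1) by
                  rw [Nat.add_sub_cancel]; ring, C_mul, hC, ih _ (by omega), mul_zero]
          rw [ih n (by omega), h2, h3, map_zero, smul_zero] at h1
          rw [pow_succ']
          simpa using h1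
    refine hψ0 (LinearMap.ext fun u => ?_)
    have hmono : ∀ (i : ℕ) (f : ℂ[X]), ψ (X ^ i * C f) = 0 := by
      intro i
      induction i with
      | zero =>
        intro f
        rw [pow_zero, one_mul]
        induction f using Polynomial.induction_on' with
        | add p q hp hq => rw [C_add, map_add, hp, hq, add_zero]
        | monomial n r => rw [← C_mul_X_pow_eq_monomial, C_mul, hC, hpow, mul_zero]
      | succ i ih => intro f; rw [pow_succ', mul_assoc, hX, ih, mul_zero]
    induction u using Polynomial.induction_on' with
    | add p q hp hq => rw [map_add, hp, hq, map_add]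
    | monomial n f => rw [← C_mul_X_pow_eq_monomial, mul_comm, hmono, LinearMap.zero_apply]
  by_contra hne
  have hcoeff : ∀ k : ℤ, (X * ψ 1).coeff (ψ 1).natDegree +
      (C (k : ℂ) * (ψ (C X)).coeff (ψ 1).natDegree -
        C ((k : ℂ) * ((k : ℂ) - 1) * α) * (ψ 1).coeff (ψ 1).natDegree) =
      (X * ψ 1).coeff (ψ 1).natDegree + (C (-(k : ℂ) * (ψ 1).natDegree) + C (k : ℂ) * X -
        C ((k : ℂ) * ((k : ℂ) - 1) * α')) * (ψ 1).coeff (ψ 1).natDegree -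
      C (k : ℂ) * (X - C ((k : ℂ) * α')) * derivative ((ψ 1).coeff (ψ 1).natDegree) := by
    intro k
    have h1 := congrArg (fun p => coeff p (ψ 1).natDegree) (hval k 1)
    simp only [C_1] at h1
    rw [coeff_smul, coeff_op k le_rfl, smul_smul, Units.inv_mul, one_smul] at h1
    rw [← h1, coeff_add, coeff_sub, coeff_sub, coeff_C_mul, coeff_C_mul]
    simp only [mul_one, derivative_one, mul_zero, map_zero, sub_zero, coeff_zero]
  have hg : (ψ 1).coeff (ψ 1).natDegree ≠ 0 := leadingCoeff_ne_zero.mpr hone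
  have h1 := hcoeff 1
  have h2 := hcoeff (-1)
  generalize (ψ 1).coeff (ψ 1).natDegree = g at h1 h2 hg
  -- Adding the cases `k = 1` and `k = -1` cancels everything odd in `k`, including the unknown `ψ
  -- (C X)`. The equation contradicts `deg g' < deg g` when `α ≠ α'`.
  have h3 : C (α' - α) * g = C α' * derivative g := by
    have h2' : (C 2 : ℂ[X]) ≠ 0 := C_ne_zero.mpr two_ne_zero
    refine mul_left_cancel₀ h2' ?_
    simp only [Int.cast_one, Int.cast_neg, C_neg, C_mul, C_sub, C_1,
      show (C 2 : ℂ[X]) = 2 from rfl] at h1 h2 ⊢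
    linear_combination h1 + h2
  have h4 := congrArg degree h3
  rw [degree_C_mul (sub_ne_zero.mpr (Ne.symm hne))] at h4
  have h5 : degree (C α' * derivative g) ≤ degree (derivative g) := by
    rw [← smul_eq_C_mul]; exact degree_smul_le _ _
  exact absurd (degree_derivative_lt hg) (not_lt.mpr (h4.trans_le h5))

end OmegaTwo

/-! ### The action on a tensor product as a sum over its factors. -/

section ActionOnFactors

variable {L : Type*} [LieRing L] [LieAlgebra ℂ L]

/-- The action on `A` is the sum of the operators `S i`, and `S i` turns `A` into a sum of copies
of `N i`. -/
structure IsFactorDecomposition {ι : Type*} [Fintype ι] (N : ι → Type*) [∀ i, AddCommGroup (N i)]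
    [∀ i, Module ℂ (N i)] [∀ i, LieRingModule L (N i)] [∀ i, LieModule ℂ L (N i)]
    {A : Type*} [AddCommGroup A] [Module ℂ A] [LieRingModule L A]
    (S : ι → L → Module.End ℂ A) : Prop where
  lie_eq_sum : ∀ y p, ⁅y, p⁆ = ∑ i, S i y p
  isSumOfCopies : ∀ i, IsSumOfCopies (fun y : L => LieModule.toEnd ℂ L (N i) y) (S i)

theorem isFactorDecomposition_piTensorProduct {ι : Type*} [Fintype ι] [DecidableEq ι]
    (N : ι → Type*) [∀ i, AddCommGroup (N i)] [∀ i, Module ℂ (N i)] [∀ i, LieRingModule L (N i)]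
    [∀ i, LieModule ℂ L (N i)] :
    IsFactorDecomposition (A := ⨂[ℂ] i, N i) N (fun i (y : L) => PiTensorLie.single i y) where
  lie_eq_sum _ _ := LinearMap.sum_apply _ _ _
  isSumOfCopies i := IsSumOfCopies.single i

section Operators

variable {ι κ α M : Type*} [AddCommGroup M] [Module ℂ M] {A B : Type*} [AddCommGroup A] [Module ℂ A]
  [AddCommGroup B] [Module ℂ B] (S : ι → α → Module.End ℂ A) (S' : κ → α → Module.End ℂ B)
  (V : Type*) [AddCommGroup V] [Module ℂ V]

/-- The operators on `(A ⊗ B) ⊗ V` induced by operators on `A` and on `B`. -/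
def factorOp : ι ⊕ κ → α → Module.End ℂ ((A ⊗[ℂ] B) ⊗[ℂ] V)
  | Sum.inl i, y => ((S i y).rTensor B).rTensor V
  | Sum.inr j, y => ((S' j y).lTensor A).rTensor V

variable {S S'} {ρ : α → Module.End ℂ M}

theorem IsSumOfCopies.factorOp_inl {i : ι} (h : IsSumOfCopies ρ (S i)) :
    IsSumOfCopies ρ (factorOp S S' V (Sum.inl i)) :=
  (h.rTensor B).rTensor V

theorem IsSumOfCopies.factorOp_inr {j : κ} (h : IsSumOfCopies ρ (S' j)) :
    IsSumOfCopies ρ (factorOp S S' V (Sum.inr j)) :=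
  (h.lTensor A).rTensor V

variable (A B) [LieRingModule L V] [LieModule ℂ L V]

/-- The operator by which `y` acts on the factor `V` of `(A ⊗ B) ⊗ V`. -/
def lastFactorOp (y : L) : Module.End ℂ ((A ⊗[ℂ] B) ⊗[ℂ] V) :=
  (LieModule.toEnd ℂ L V y).lTensor _

theorem isSumOfCopies_lastFactorOp :
    IsSumOfCopies (fun y : L => LieModule.toEnd ℂ L V y) (lastFactorOp A B V) :=
  (IsSumOfCopies.refl _).lTensor (A ⊗[ℂ] B)

end Operators

theorem lie_eq_sum_factorOp {ι κ : Type*} [Fintype ι] [Fintype κ]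
    {N : ι → Type*} [∀ i, AddCommGroup (N i)] [∀ i, Module ℂ (N i)]
    [∀ i, LieRingModule L (N i)] [∀ i, LieModule ℂ L (N i)]
    {P : κ → Type*} [∀ i, AddCommGroup (P i)] [∀ i, Module ℂ (P i)]
    [∀ i, LieRingModule L (P i)] [∀ i, LieModule ℂ L (P i)]
    {A B : Type*} [AddCommGroup A] [Module ℂ A] [LieRingModule L A] [LieModule ℂ L A]
    [AddCommGroup B] [Module ℂ B] [LieRingModule L B] [LieModule ℂ L B]
    {S : ι → L → Module.End ℂ A} {S' : κ → L → Module.End ℂ B}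
    (V : Type*) [AddCommGroup V] [Module ℂ V] [LieRingModule L V] [LieModule ℂ L V]
    (hS : IsFactorDecomposition N S) (hS' : IsFactorDecomposition P S')
    (y : L) (x : (A ⊗[ℂ] B) ⊗[ℂ] V) :
    ⁅y, x⁆ = ∑ i, factorOp S S' V i y x + lastFactorOp A B V y x := by
  induction x using TensorProduct.induction_on with
  | zero => simp
  | add x x' hx hx' =>
    simp only [lie_add, hx, hx', map_add, Finset.sum_add_distrib]
    abel
  | tmul u v =>
    rw [TensorProduct.LieModule.lie_tmul_right]
    congr 1
    induction u using TensorProduct.induction_on with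
    | zero => simp [factorOp]
    | add u u' hu hu' =>
      simp only [lie_add, TensorProduct.add_tmul, hu, hu', map_add, Finset.sum_add_distrib]
    | tmul p q =>
      rw [TensorProduct.LieModule.lie_tmul_right, hS.lie_eq_sum, hS'.lie_eq_sum,
        Fintype.sum_sum_type]
      simp only [factorOp, LinearMap.rTensor_tmul, LinearMap.lTensor_tmul, TensorProduct.sum_tmul,
        TensorProduct.tmul_sum, TensorProduct.add_tmul]

end ActionOnFactors

theorem nontrivial_tensorProduct (A B : Type*) [AddCommGroup A] [Module ℂ A] [AddCommGroup B]
    [Module ℂ B] [Nontrivial A] [Nontrivial B] : Nontrivial (A ⊗[ℂ] B) := by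
  let b := (Module.Basis.ofVectorSpace ℂ A).tensorProduct (Module.Basis.ofVectorSpace ℂ B)
  obtain ⟨i⟩ := (Module.Basis.ofVectorSpace ℂ A).index_nonempty
  obtain ⟨j⟩ := (Module.Basis.ofVectorSpace ℂ B).index_nonempty
  exact ⟨_, _, b.ne_zero (i, j)⟩

theorem nontrivial_piTensorProduct {ι : Type*} [Finite ι] (N : ι → Type*)
    [∀ i, AddCommGroup (N i)] [∀ i, Module ℂ (N i)] [∀ i, Nontrivial (N i)] :
    Nontrivial (⨂[ℂ] i, N i) := by
  let b := Basis.piTensorProduct fun i => Module.Basis.ofVectorSpace ℂ (N i)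
  exact ⟨_, _, b.ne_zero fun i => (Module.Basis.ofVectorSpace ℂ (N i)).index_nonempty.some⟩

namespace IsSumOfCopies

variable {κ M T : Type*} [AddCommGroup M] [Module ℂ M] [AddCommGroup T] [Module ℂ T]
  {ρ : κ → Module.End ℂ M} {σ : κ → Module.End ℂ T}

theorem apply_eq_zero (h : IsSumOfCopies ρ σ) {a : κ} (ha : ∀ u, ρ a u = 0) (x : T) :
    σ a x = 0 := by
  by_contra hx
  obtain ⟨g, hg, hgx⟩ := h.separating _ hx
  exact hgx (by rw [hg, ha])

theorem exists_apply_ne_zero [Nontrivial T] (h : IsSumOfCopies ρ σ) {a : κ}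
    (ha : ∀ u, ρ a u = 0 → u = 0) : ∃ x, σ a x ≠ 0 := by
  obtain ⟨x, hx⟩ := exists_ne (0 : T)
  obtain ⟨g, hg, hgx⟩ := h.separating _ hx
  exact ⟨x, fun h0 => hgx (ha _ (by rw [← hg, h0, map_zero]))⟩

end IsSumOfCopies

namespace OmegaOne

instance (mu : ℂˣ) (β : ℂ) : Nontrivial (OmegaOne mu β) := inferInstanceAs (Nontrivial ℂ[X])

variable {mu mu' : ℂˣ} {β β' : ℂ}

theorem lie_d_eq_op (k : ℤ) (u : OmegaOne mu β) : ⁅Vir.d k, u⁆ = op mu β k u :=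
  Vir.ofOperators_lie_d (M := OmegaOne mu β) (op mu β) (op_lie mu β) k u

theorem isExpPoly_lie (u : OmegaOne mu β) : IsExpPoly (mu : ℂ) (fun k => ⁅Vir.d k, u⁆) := by
  simp only [lie_d_eq_op]
  exact isExpPoly_op mu β u

/-- Multiplication by `∂` is injective; this prevents an isomorphism from annihilating the operators
of an `Ω` factor. -/
theorem eq_zero_of_lie_d_zero (u : OmegaOne mu β) (h : ⁅Vir.d 0, u⁆ = 0) : u = 0 := by
  have h' : op mu β 0 u = 0 := (lie_d_eq_op 0 u).symm.trans h
  have key : ∀ f : ℂ[X], op mu β 0 f = 0 → f = 0 := by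
    intro f hf
    have : f * X = 0 := by simpa [op_apply] using hf
    exact (mul_eq_zero.mp this).resolve_right X_ne_zero
  exact key u h'

theorem eq_of_lie_intertwiner (h : mu = mu') (hβ' : β' ≠ 0)
    {ψ : OmegaOne mu β →ₗ[ℂ] OmegaOne mu' β'} (hψ0 : ψ ≠ 0)
    (hψ : ∀ k u, ψ ⁅Vir.d k, u⁆ = ⁅Vir.d k, ψ u⁆) : β = β' := by
  subst h
  simp only [lie_d_eq_op] at hψ
  exact eq_of_intertwiner hβ' hψ0 hψ

end OmegaOne

namespace OmegaTwo

instance (lam : ℂˣ) (α : ℂ) (h : ℂ[X]) : Nontrivial (OmegaTwo lam α h) :=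
  inferInstanceAs (Nontrivial ℂ[X][X])

variable {lam lam' : ℂˣ} {α α' : ℂ} {h : ℂ[X]}

theorem lie_d_eq_op (k : ℤ) (u : OmegaTwo lam α h) : ⁅Vir.d k, u⁆ = op lam α h k u :=
  Vir.ofOperators_lie_d (M := OmegaTwo lam α h) (op lam α h) (op_lie lam α h) k u

theorem isExpPoly_lie (u : OmegaTwo lam α h) : IsExpPoly (lam : ℂ) (fun k => ⁅Vir.d k, u⁆) := by
  simp only [lie_d_eq_op]
  exact isExpPoly_op lam α h u

theorem eq_zero_of_lie_d_zero (u : OmegaTwo lam α X) (h : ⁅Vir.d 0, u⁆ = 0) : u = 0 := by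
  have key : ∀ f : ℂ[X][X], op lam α X 0 f = 0 → f = 0 := by
    intro f hf
    rw [op_zero] at hf
    exact (mul_eq_zero.mp hf).resolve_left X_ne_zero
  exact key u ((lie_d_eq_op 0 u).symm.trans h)

theorem eq_of_lie_intertwiner (h : lam = lam') {ψ : OmegaTwo lam α X →ₗ[ℂ] OmegaTwo lam' α' X}
    (hψ0 : ψ ≠ 0) (hψ : ∀ k u, ψ ⁅Vir.d k, u⁆ = ⁅Vir.d k, ψ u⁆) : α = α' := by
  subst h
  simp only [lie_d_eq_op] at hψ
  exact eq_of_intertwiner hψ0 hψ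

theorem not_lie_intertwiner_omegaOne (h : lam = lam') {β : ℂ}
    {ψ : OmegaOne lam β →ₗ[ℂ] OmegaTwo lam' α X} (hψ0 : ψ ≠ 0)
    (hψ : ∀ k u, ψ ⁅Vir.d k, u⁆ = ⁅Vir.d k, ψ u⁆) : False := by
  subst h
  simp only [lie_d_eq_op, OmegaOne.lie_d_eq_op] at hψ
  exact not_intertwiner_omegaOne hψ0 hψ

end OmegaTwo

/-- Schur's lemma: a nonzero map of irreducible modules is an isomorphism. -/
theorem nonempty_lieModuleEquiv_of_ne_zero {L V V' : Type*} [LieRing L] [LieAlgebra ℂ L]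
    [AddCommGroup V] [Module ℂ V] [LieRingModule L V] [LieModule ℂ L V]
    [AddCommGroup V'] [Module ℂ V'] [LieRingModule L V'] [LieModule ℂ L V']
    (hirr : LieModule.IsIrreducible ℂ L V) (hirr' : LieModule.IsIrreducible ℂ L V')
    (ψ : V →ₗ[ℂ] V') (hψ0 : ψ ≠ 0) (hψ : ∀ (y : L) u, ψ ⁅y, u⁆ = ⁅y, ψ u⁆) :
    Nonempty (V ≃ₗ⁅ℂ, L⁆ V') := by
  let f : V →ₗ⁅ℂ, L⁆ V' := { ψ with map_lie' := fun {y u} => hψ y u }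
  have hf : ∀ u, f u = ψ u := fun _ => rfl
  have hker : f.ker = ⊥ := (hirr.eq_bot_or_eq_top _).resolve_right fun h =>
    hψ0 (LinearMap.ext fun u => by
      have : u ∈ f.ker := h ▸ LieSubmodule.mem_top u
      exact f.mem_ker.mp this)
  have hran : f.range = ⊤ := (hirr'.eq_bot_or_eq_top _).resolve_left fun h =>
    hψ0 (LinearMap.ext fun u => by
      have : f u ∈ f.range := (f.mem_range _).mpr ⟨u, rfl⟩
      rw [h, LieSubmodule.mem_bot] at this
      exact this)
  have hinj : Function.Injective ψ := (injective_iff_map_eq_zero ψ).mpr fun u hu => by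
    have : u ∈ f.ker := f.mem_ker.mpr hu
    rwa [hker, LieSubmodule.mem_bot] at this
  have hsurj : Function.Surjective ψ := fun v => by
    have : v ∈ f.range := hran ▸ LieSubmodule.mem_top v
    exact (f.mem_range _).mp this
  let e := LinearEquiv.ofBijective ψ ⟨hinj, hsurj⟩
  exact ⟨{ f with
    invFun := e.symm
    left_inv := e.symm_apply_apply
    right_inv := e.apply_symm_apply }⟩

/-! ### Matching the factors of two isomorphic tensor products. -/

section Main

variable {m n m' n' : ℕ}
  {lam : Fin m → ℂˣ} {a : Fin m → ℂ} {mu : Fin n → ℂˣ} {β : Fin n → ℂ}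
  {lam' : Fin m' → ℂˣ} {a' : Fin m' → ℂ} {mu' : Fin n' → ℂˣ} {β' : Fin n' → ℂ}
  {A B A' B' : Type*}
  [AddCommGroup A] [Module ℂ A] [LieRingModule Vir A] [AddCommGroup B] [Module ℂ B]
  [LieRingModule Vir B] [AddCommGroup A'] [Module ℂ A'] [LieRingModule Vir A']
  [AddCommGroup B'] [Module ℂ B'] [LieRingModule Vir B']
  {S : Fin m → Vir → Module.End ℂ A} {R : Fin n → Vir → Module.End ℂ B}
  {S' : Fin m' → Vir → Module.End ℂ A'} {R' : Fin n' → Vir → Module.End ℂ B'}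
  {V : Type*} [AddCommGroup V] [Module ℂ V] {V' : Type*} [AddCommGroup V'] [Module ℂ V']

theorem isExpPoly_factorOp (hS : IsFactorDecomposition (fun i => OmegaTwo (lam i) (a i) X) S)
    (hR : IsFactorDecomposition (fun j => OmegaOne (mu j) (β j)) R) (i : Fin m ⊕ Fin n)
    (x : (A ⊗[ℂ] B) ⊗[ℂ] V) :
    IsExpPoly (Sum.elim lam mu i : ℂˣ).val (fun k => factorOp S R V i (Vir.d k) x) := by
  rcases i with i | j
  · exact (((hS.isSumOfCopies i).factorOp_inl V).comp_index Vir.d).isExpPoly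
      (fun u => OmegaTwo.isExpPoly_lie u) x
  · exact (((hR.isSumOfCopies j).factorOp_inr V).comp_index Vir.d).isExpPoly
      (fun u => OmegaOne.isExpPoly_lie u) x

theorem exists_factorOp_ne_zero [Nontrivial ((A ⊗[ℂ] B) ⊗[ℂ] V)]
    (hS : IsFactorDecomposition (fun i => OmegaTwo (lam i) (a i) X) S)
    (hR : IsFactorDecomposition (fun j => OmegaOne (mu j) (β j)) R) (i : Fin m ⊕ Fin n) :
    ∃ x, factorOp S R V i (Vir.d 0) x ≠ 0 := by
  rcases i with i | j
  · exact ((hS.isSumOfCopies i).factorOp_inl V).exists_apply_ne_zero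
      fun u hu => OmegaTwo.eq_zero_of_lie_d_zero u hu
  · exact ((hR.isSumOfCopies j).factorOp_inr V).exists_apply_ne_zero
      fun u hu => OmegaOne.eq_zero_of_lie_d_zero u hu

theorem factorOp_c (hS : IsFactorDecomposition (fun i => OmegaTwo (lam i) (a i) X) S)
    (hR : IsFactorDecomposition (fun j => OmegaOne (mu j) (β j)) R) (i : Fin m ⊕ Fin n)
    (x : (A ⊗[ℂ] B) ⊗[ℂ] V) : factorOp S R V i Vir.c x = 0 := by
  rcases i with i | j
  · exact ((hS.isSumOfCopies i).factorOp_inl V).apply_eq_zero (OmegaTwo.lie_c _ _ _) x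
  · exact ((hR.isSumOfCopies j).factorOp_inr V).apply_eq_zero (OmegaOne.lie_c _ _) x

variable [LieModule ℂ Vir A] [LieModule ℂ Vir B] [LieModule ℂ Vir A'] [LieModule ℂ Vir B']
  [LieRingModule Vir V] [LieModule ℂ Vir V] [LieRingModule Vir V'] [LieModule ℂ Vir V']

/-- An isomorphism of tensor products matches the factors. -/
theorem exists_matching [Nontrivial ((A ⊗[ℂ] B) ⊗[ℂ] V)] (hβ' : ∀ j, β' j ≠ 0)
    (hdist : Function.Injective (Sum.elim lam mu))
    (hdist' : Function.Injective (Sum.elim lam' mu'))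
    (hS : IsFactorDecomposition (fun i => OmegaTwo (lam i) (a i) X) S)
    (hR : IsFactorDecomposition (fun j => OmegaOne (mu j) (β j)) R)
    (hS' : IsFactorDecomposition (fun i => OmegaTwo (lam' i) (a' i) X) S')
    (hR' : IsFactorDecomposition (fun j => OmegaOne (mu' j) (β' j)) R')
    (hirr : LieModule.IsIrreducible ℂ Vir V) (hirr' : LieModule.IsIrreducible ℂ Vir V')
    (hV : ∀ v : V, ∃ N : ℤ, ∀ k ≥ N, ⁅Vir.d k, v⁆ = 0)
    (hV' : ∀ v : V', ∃ N : ℤ, ∀ k ≥ N, ⁅Vir.d k, v⁆ = 0)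
    (φ : ((A ⊗[ℂ] B) ⊗[ℂ] V) ≃ₗ⁅ℂ, Vir⁆ ((A' ⊗[ℂ] B') ⊗[ℂ] V')) :
    (∀ i, ∃ i', lam' i' = lam i ∧ a' i' = a i) ∧ (∀ j, ∃ j', mu' j' = mu j ∧ β' j' = β j) ∧
      Nonempty (V ≃ₗ⁅ℂ, Vir⁆ V') := by
  let φ₀ : ((A ⊗[ℂ] B) ⊗[ℂ] V) ≃ₗ[ℂ] ((A' ⊗[ℂ] B') ⊗[ℂ] V') := φ.toLinearEquiv
  have hlie : ∀ (y : Vir) x, φ₀ ⁅y, x⁆ = ⁅y, φ₀ x⁆ := fun y x => φ.toLieModuleHom.map_lie y x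
  have hne : φ₀.toLinearMap ≠ 0 := fun h0 => by
    obtain ⟨x, hx⟩ := exists_ne (0 : (A ⊗[ℂ] B) ⊗[ℂ] V)
    exact hx (φ₀.injective ((LinearMap.congr_fun h0 x).trans (map_zero _).symm))
  have hne' : φ₀.symm.toLinearMap ≠ 0 := fun h0 => by
    obtain ⟨x, hx⟩ := exists_ne (0 : (A ⊗[ℂ] B) ⊗[ℂ] V)
    exact hx ((φ₀.symm_apply_apply x).symm.trans (LinearMap.congr_fun h0 (φ₀ x)))
  obtain ⟨h1, h2, h3⟩ := intertwine_of_sum hdist hdist'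
    (E := fun i k => factorOp S R V i (Vir.d k)) (E' := fun i k => factorOp S' R' V' i (Vir.d k))
    (G := fun k => lastFactorOp A B V (Vir.d k)) (G' := fun k => lastFactorOp A' B' V' (Vir.d k))
    (isExpPoly_factorOp hS hR) (isExpPoly_factorOp hS' hR')
    (((isSumOfCopies_lastFactorOp A B V).comp_index Vir.d).eventually_zero hV)
    (((isSumOfCopies_lastFactorOp A' B' V').comp_index Vir.d).eventually_zero hV')
    φ₀.toLinearMap (fun k x => by
      rw [← lie_eq_sum_factorOp V hS hR, ← lie_eq_sum_factorOp V' hS' hR']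
      exact hlie _ _)
  -- A base missing on the other side would make `φ` kill the operators of the factor `i`, but its
  -- `d 0` is nonzero.
  have hmatch : ∀ i, ∃ i', Sum.elim lam mu i = Sum.elim lam' mu' i' := by
    intro i
    by_contra! hcon
    obtain ⟨x, hx⟩ := exists_factorOp_ne_zero (V := V) hS hR i
    exact hx (φ₀.injective ((h2 i (fun i' => (hcon i').symm) 0 x).trans (map_zero _).symm))
  refine ⟨fun i => ?_, fun j => ?_, ?_⟩
  · obtain ⟨i' | j', hi'⟩ := hmatch (Sum.inl i)
    · obtain ⟨ψ, hψ0, hψ⟩ := (((hS.isSumOfCopies i).factorOp_inl (S' := R) V).comp_index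
        Vir.d).exists_intertwiner (((hS'.isSumOfCopies i').factorOp_inl (S' := R') V').comp_index
        Vir.d) φ₀.toLinearMap hne (h1 _ _ hi')
      exact ⟨i', hi'.symm, (OmegaTwo.eq_of_lie_intertwiner hi' hψ0 hψ).symm⟩
    -- Only maps `Ω(λ,β) → Ω(λ,a,t)` have been excluded, so the inverse of `φ` is used here.
    · obtain ⟨ψ, hψ0, hψ⟩ := (((hR'.isSumOfCopies j').factorOp_inr (S := S') V').comp_index
        Vir.d).exists_intertwiner (((hS.isSumOfCopies i).factorOp_inl (S' := R) V).comp_index Vir.d)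
        φ₀.symm.toLinearMap hne' (fun k x => by
          have := h1 _ _ hi' k (φ₀.symm x)
          rw [LinearEquiv.coe_coe, LinearEquiv.apply_symm_apply] at this
          rw [LinearEquiv.coe_coe, ← this, LinearEquiv.symm_apply_apply])
      exact (OmegaTwo.not_lie_intertwiner_omegaOne hi'.symm hψ0 hψ).elim
  · obtain ⟨i' | j', hj'⟩ := hmatch (Sum.inr j)
    · obtain ⟨ψ, hψ0, hψ⟩ := (((hR.isSumOfCopies j).factorOp_inr (S := S) V).comp_index
        Vir.d).exists_intertwiner (((hS'.isSumOfCopies i').factorOp_inl (S' := R') V').comp_index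
        Vir.d) φ₀.toLinearMap hne (h1 _ _ hj')
      exact (OmegaTwo.not_lie_intertwiner_omegaOne hj' hψ0 hψ).elim
    · obtain ⟨ψ, hψ0, hψ⟩ := (((hR.isSumOfCopies j).factorOp_inr (S := S) V).comp_index
        Vir.d).exists_intertwiner (((hR'.isSumOfCopies j').factorOp_inr (S := S') V').comp_index
        Vir.d) φ₀.toLinearMap hne (h1 _ _ hj')
      exact ⟨j', hj'.symm, (OmegaOne.eq_of_lie_intertwiner hj' (hβ' j') hψ0 hψ).symm⟩
  -- The separation of bases only concerns the `d k`. The element `c` acts by zero on all `Ω`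
  -- factors, so its action on the whole product is that on the last factor.
  · have h4 : ∀ (y : Vir) x, φ₀ (lastFactorOp A B V y x) = lastFactorOp A' B' V' y (φ₀ x) := by
      intro y x
      induction y using Vir.induction_on with
      | hd i => exact h3 i x
      | hc =>
        have := hlie Vir.c x
        rw [lie_eq_sum_factorOp V hS hR, lie_eq_sum_factorOp V' hS' hR',
          Finset.sum_eq_zero fun i _ => factorOp_c hS hR i x,
          Finset.sum_eq_zero fun i _ => factorOp_c hS' hR' i (φ₀ x), zero_add, zero_add] at this
        exact this
      | hadd y z hy hz =>
        simp only [lastFactorOp, map_add, LinearMap.lTensor_add, LinearMap.add_apply] at hy hz ⊢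
        rw [hy, hz]
      | hsmul r y hy =>
        simp only [lastFactorOp, map_smul, LinearMap.lTensor_smul, LinearMap.smul_apply] at hy ⊢
        rw [hy]
    obtain ⟨ψ, hψ0, hψ⟩ := (isSumOfCopies_lastFactorOp A B V).exists_intertwiner
      (isSumOfCopies_lastFactorOp A' B' V') φ₀.toLinearMap hne h4
    exact nonempty_lieModuleEquiv_of_ne_zero hirr hirr' ψ hψ0 hψ

end Main

/-! ### Isomorphisms of tensor products -/

section Congr

variable {L : Type*} [LieRing L] [LieAlgebra ℂ L]

theorem nonempty_tensorProduct_congr {A B A' B' : Type*}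
    [AddCommGroup A] [Module ℂ A] [LieRingModule L A] [LieModule ℂ L A]
    [AddCommGroup B] [Module ℂ B] [LieRingModule L B] [LieModule ℂ L B]
    [AddCommGroup A'] [Module ℂ A'] [LieRingModule L A'] [LieModule ℂ L A']
    [AddCommGroup B'] [Module ℂ B'] [LieRingModule L B'] [LieModule ℂ L B']
    (e : A ≃ₗ⁅ℂ, L⁆ A') (f : B ≃ₗ⁅ℂ, L⁆ B') : Nonempty ((A ⊗[ℂ] B) ≃ₗ⁅ℂ, L⁆ (A' ⊗[ℂ] B')) :=
  let g := TensorProduct.congr e.toLinearEquiv f.toLinearEquiv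
  ⟨{ TensorProduct.LieModule.map e.toLieModuleHom f.toLieModuleHom with
    invFun := g.symm
    left_inv := g.symm_apply_apply
    right_inv := g.apply_symm_apply }⟩

theorem nonempty_piTensorProduct_reindex {ι ι' : Type*} [Fintype ι] [Fintype ι'] [DecidableEq ι]
    [DecidableEq ι'] (e : ι ≃ ι') (N : ι' → Type*) [∀ i, AddCommGroup (N i)] [∀ i, Module ℂ (N i)]
    [∀ i, LieRingModule L (N i)] [∀ i, LieModule ℂ L (N i)] :
    Nonempty ((⨂[ℂ] i, N (e i)) ≃ₗ⁅ℂ, L⁆ (⨂[ℂ] i', N i')) := by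
  -- Reindexing along `e.symm` has the family `N (e i)` as its target definitionally, so the inverse
  -- direction is built and then inverted.
  let g : (⨂[ℂ] i', N i') ≃ₗ[ℂ] (⨂[ℂ] i, N (e i)) := PiTensorProduct.reindex ℂ N e.symm
  have hg : ∀ v : ∀ i', N i', g (PiTensorProduct.tprod ℂ v) =
      PiTensorProduct.tprod ℂ fun i => v (e i) := fun v => PiTensorProduct.reindex_tprod e.symm v
  have hlie : ∀ (y : L) x, g ⁅y, x⁆ = ⁅y, g x⁆ := by
    intro y x
    induction x using PiTensorProduct.induction_on with
    | smul_tprod r v =>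
      rw [lie_smul, map_smul, map_smul, lie_smul, PiTensorLie.lie_tprod, map_sum, hg,
        PiTensorLie.lie_tprod]
      congr 1
      rw [← e.sum_comp]
      refine Finset.sum_congr rfl fun i _ => ?_
      rw [hg]
      congr 1
      funext j
      by_cases h : j = i
      · subst h; simp
      · simp [h]
    | add x x' hx hx' => rw [lie_add, map_add, map_add, lie_add, hx, hx']
  exact ⟨{ g.symm with
    map_lie' := fun {y x} => g.injective (by
      change g (g.symm ⁅y, x⁆) = g ⁅y, g.symm x⁆
      rw [hlie, g.apply_symm_apply, g.apply_symm_apply]) }⟩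

end Congr

/-- Injectivity of the labels `l` and `l'` makes the two choice functions mutually inverse. -/
theorem exists_equiv_of_matching {ι ι' γ δ : Type*} {l : ι → γ} {b : ι → δ} {l' : ι' → γ}
    {b' : ι' → δ} (hl : Function.Injective l) (hl' : Function.Injective l')
    (h : ∀ i, ∃ i', l' i' = l i ∧ b' i' = b i) (h' : ∀ i', ∃ i, l i = l' i' ∧ b i = b' i') :
    ∃ σ : ι ≃ ι', ∀ i, l' (σ i) = l i ∧ b' (σ i) = b i := by
  choose f hf using h
  choose g hg using h'
  exact ⟨⟨f, g, fun i => hl (by rw [(hg _).1, (hf _).1]), fun i => hl' (by rw [(hf _).1, (hg _).1])⟩,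
    hf⟩

end

theorem proposition4p2
    (m n m' n' : ℕ)
    (lam : Fin m → ℂˣ) (a : Fin m → ℂ) (mu : Fin n → ℂˣ) (β : Fin n → ℂ)
    (lam' : Fin m' → ℂˣ) (a' : Fin m' → ℂ) (mu' : Fin n' → ℂˣ) (β' : Fin n' → ℂ)
    (ha : ∀ i, a i ≠ 0) (hβ : ∀ j, β j ≠ 0) (ha' : ∀ i, a' i ≠ 0) (hβ' : ∀ j, β' j ≠ 0)
    (hdist : Function.Injective (Sum.elim lam mu))
    (hdist' : Function.Injective (Sum.elim lam' mu'))
    (V : Type*) [AddCommGroup V] [Module ℂ V] [LieRingModule Vir V] [LieModule ℂ Vir V]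
    (V' : Type*) [AddCommGroup V'] [Module ℂ V'] [LieRingModule Vir V'] [LieModule ℂ Vir V']
    (hirr : LieModule.IsIrreducible ℂ Vir V) (hirr' : LieModule.IsIrreducible ℂ Vir V')
    (K : ℤ) (hK : ∀ k > K, Vir.ActsLocallyFinitely V k)
    (hK' : ∀ k > K, Vir.ActsLocallyFinitely V' k) :
    Nonempty
      ((((⨂[ℂ] i, OmegaTwo (lam i) (a i) X) ⊗[ℂ] (⨂[ℂ] j, OmegaOne (mu j) (β j))) ⊗[ℂ] V)
        ≃ₗ⁅ℂ, Vir⁆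
      (((⨂[ℂ] i, OmegaTwo (lam' i) (a' i) X) ⊗[ℂ] (⨂[ℂ] j, OmegaOne (mu' j) (β' j))) ⊗[ℂ] V'))
    ↔
      m = m' ∧ n = n' ∧ Nonempty (V ≃ₗ⁅ℂ, Vir⁆ V') ∧
      (∃ σ : Fin m ≃ Fin m', ∀ i, lam' (σ i) = lam i ∧ a' (σ i) = a i) ∧
      (∃ τ : Fin n ≃ Fin n', ∀ j, mu' (τ j) = mu j ∧ β' (τ j) = β j) := by
  constructor
  · rintro ⟨φ⟩
    have hnt : ∀ {q r : ℕ} (l : Fin q → ℂˣ) (b : Fin q → ℂ) (u : Fin r → ℂˣ) (c : Fin r → ℂ)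
        (W : Type _) [AddCommGroup W] [Module ℂ W] [Nontrivial W],
        Nontrivial (((⨂[ℂ] i, OmegaTwo (l i) (b i) X) ⊗[ℂ] (⨂[ℂ] j, OmegaOne (u j) (c j)))
          ⊗[ℂ] W) := by
      intro q r l b u c W _ _ _
      have := nontrivial_piTensorProduct fun i => OmegaTwo (l i) (b i) X
      have := nontrivial_piTensorProduct fun j => OmegaOne (u j) (c j)
      have := nontrivial_tensorProduct (⨂[ℂ] i, OmegaTwo (l i) (b i) X)
        (⨂[ℂ] j, OmegaOne (u j) (c j))
      exact nontrivial_tensorProduct _ W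
    have := LieModule.nontrivial_of_isIrreducible ℂ Vir V
    have := hnt lam a mu β V
    have := φ.toLinearEquiv.symm.toEquiv.nontrivial
    have hV := Vir.exists_forall_lie_eq_zero hirr hK
    have hV' := Vir.exists_forall_lie_eq_zero hirr' hK'
    obtain ⟨h1, h2, h3⟩ := exists_matching hβ' hdist hdist'
      (isFactorDecomposition_piTensorProduct _) (isFactorDecomposition_piTensorProduct _)
      (isFactorDecomposition_piTensorProduct _) (isFactorDecomposition_piTensorProduct _)
      hirr hirr' hV hV' φ
    -- The inverse isomorphism gives the matching in the other direction, which makes both matchings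
    -- bijective.
    obtain ⟨h1', h2', -⟩ := exists_matching hβ hdist' hdist
      (isFactorDecomposition_piTensorProduct _) (isFactorDecomposition_piTensorProduct _)
      (isFactorDecomposition_piTensorProduct _) (isFactorDecomposition_piTensorProduct _)
      hirr' hirr hV' hV φ.symm
    obtain ⟨σ, hσ⟩ := exists_equiv_of_matching (hdist.comp Sum.inl_injective)
      (hdist'.comp Sum.inl_injective) h1 h1'
    obtain ⟨τ, hτ⟩ := exists_equiv_of_matching (hdist.comp Sum.inr_injective)
      (hdist'.comp Sum.inr_injective) h2 h2'
    exact ⟨Fin.equiv_iff_eq.mp ⟨σ⟩, Fin.equiv_iff_eq.mp ⟨τ⟩, h3, ⟨σ, hσ⟩, ⟨τ, hτ⟩⟩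
  · rintro ⟨-, -, ⟨e⟩, ⟨σ, hσ⟩, ⟨τ, hτ⟩⟩
    -- After substitution the left-hand factors are literally the right-hand ones reindexed along
    -- `σ` and `τ`.
    obtain rfl : (fun i => lam' (σ i)) = lam := funext fun i => (hσ i).1
    obtain rfl : (fun i => a' (σ i)) = a := funext fun i => (hσ i).2
    obtain rfl : (fun j => mu' (τ j)) = mu := funext fun j => (hτ j).1
    obtain rfl : (fun j => β' (τ j)) = β := funext fun j => (hτ j).2
    obtain ⟨f⟩ := nonempty_piTensorProduct_reindex (L := Vir) σ
      fun i => OmegaTwo (lam' i) (a' i) X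
    obtain ⟨g⟩ := nonempty_piTensorProduct_reindex (L := Vir) τ fun j => OmegaOne (mu' j) (β' j)
    obtain ⟨p⟩ := nonempty_tensorProduct_congr f g
    exact nonempty_tensorProduct_congr p e
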